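/- Let $c_1,c_2>0$ and $g,h\in\mathbb R$. Consider the closed loop of two wave equations $$ \begin{aligned} &u_{tt}=c_1^2u_{xx},\qquad v_{tt}=c_2^2v_{xx},\qquad x\in(0,1),\ t\ge 0,\\ &u_x(0,t)=g\,u_t(0,t),\qquad u(1,t)=v(0,t),\qquad v_x(0,t)=u_x(1,t),\qquad v_x(1,t)=-h\,v_t(1,t)-q\,v(1,t), \end{aligned} $$ with $q=0$ and initial data $(u^0,u_t^0,v^0,v_t^0)\in\mathcal H$, where $$\mathcal H=\{(u,p,v,r)\in H^1\times L^2\times H^1\times L^2:\ u(1)=v(0)\}$$ (spaces over $[0,1]$) carries the topology of $H^1\times L^2\times H^1\times L^2$ and the seminorm $$\|(u,p,v,r)\|_{\mathcal H}^2=c_1^2\|u_x\|_{L^2}^2+\|p\|_{L^2}^2+c_2^2\|v_x\|_{L^2}^2+\|r\|_{L^2}^2 .$$ Solutions are mild solutions: $z\in C([0,\infty);\mathcal H)$ such that for every $t\ge0$, $\int_0^tz(s)\,ds\in D(T)$ and $z(t)=z(0)+T\int_0^tz(s)\,ds$, where $T(u,p,v,r)=(p,c_1^2u_{xx},r,c_2^2v_{xx})$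 and $D(T)$ consists of the $(u,p,v,r)\in\mathcal H$ with $u,v\in H^2$, $p,r\in H^1$, $p(1)=r(0)$, $u_x(0)=g\,p(0)$, $v_x(0)=u_x(1)$, $v_x(1)=-h\,r(1)-q\,v(1)$. For $S_1,\dots,S_5>0$ and $\alpha\in\mathbb R$ let $S=\mathrm{diag}(S_1,S_2,S_3,S_4)$, $E_\alpha(1)=\mathrm{diag}(e^{2\alpha/c_1},e^{2\alpha/c_1},e^{2\alpha/c_2},e^{2\alpha/c_2})$, $$ H=\begin{bmatrix}0&c_1&1&0&0\\1-c_1g&0&0&0&0\\0&0&0&1-c_2h&-c_2q\\0&-c_2&1&0&0\end{bmatrix},\qquad G=\begin{bmatrix}1+c_1g&0&0&0&0\\0&-c_1&1&0&0\\0&c_2&1&0&0\\0&0&0&1+c_2h&c_2q\end{bmatrix}, $$ $$ Q_\alpha=\mathrm{diag}\left(0_{3,3},\begin{bmatrix}0&S_5\\S_5&2\alpha S_5\end{bmatrix}\right),\qquad \Psi(\alpha)=H^\top E_\alpha(1)SH-G^\top SG+Q_\alpha , $$ and let $\tilde\Psi$ be the $4\times4$ matrix obtained from $\Psi(0)$ by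 deleting its last row and column (it does not depend on $S_5$ or $q$). Suppose that there are $S_1,S_2,S_3,S_4>0$ such that $\tilde\Psi\prec0$. Then for every initial condition $z_0=(u^0,u_t^0,v^0,v_t^0)\in\mathcal H$ the closed loop with $q=0$ has a unique solution $z=(u,u_t,v,v_t)$ on $[0,\infty)$ with $z(0)=z_0$, and it is $\mathcal H$-exponentially stable: there are $\gamma>1$ and $\alpha>0$, independent of the initial condition, such that $$\|z(t)\|_{\mathcal H}\le\gamma\,\|z_0\|_{\mathcal H}\,e^{-\alpha t}\qquad\text{for all }t\ge0 .$$ -/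

import Mathlib

namespace WaveLoop

open MeasureTheory Set

noncomputable section

/-! ### Function spaces on the unit interval -/

/-- Lebesgue measure on `[0,1]`. -/
abbrev vol01 : Measure ℝ := volume.restrict (Icc (0 : ℝ) 1)

/-- `L² = L²([0,1]; ℝ)`. -/
abbrev L2 : Type := Lp ℝ 2 vol01

/-- The integral of an `L²` function over `[0,x]` is the inner product with an indicator
function; hence it is linear and continuous in the function. -/
theorem integral_eq_inner (w : L2) (x : Icc (0 : ℝ) 1) :
    (∫ y in (0 : ℝ)..x, w y) =
      inner ℝ (indicatorConstLp 2 (μ := vol01) (measurableSet_Ioc (a := (0 : ℝ)) (b := x))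
        (measure_ne_top _ _) (1 : ℝ)) w := by
  rw [L2.inner_indicatorConstLp_one, intervalIntegral.integral_of_le x.2.1,
    Measure.restrict_restrict measurableSet_Ioc]
  congr 2
  ext y
  simp only [mem_Ioc, mem_inter_iff, mem_Icc]
  constructor
  · intro hy
    exact ⟨hy, hy.1.le, hy.2.trans x.2.2⟩
  · intro hy
    exact hy.1

/-- The Sobolev space `H¹ = H¹(0,1)`. Its elements are exactly the absolutely continuous functions
on `[0,1]` with derivative in `L²`; an element is stored as the pair of its continuous
representative and its weak derivative. The topology is that of uniform convergence of the function
and `L²` convergence of the derivative, which is the usual `H¹` topology. -/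
def H1Submodule : Submodule ℝ (C(Icc (0 : ℝ) 1, ℝ) × L2) where
  carrier := {f | ∀ x : Icc (0 : ℝ) 1, f.1 x = f.1 0 + ∫ y in (0 : ℝ)..x, f.2 y}
  add_mem' := by
    intro a b ha hb x
    have h1 := ha x
    have h2 := hb x
    rw [integral_eq_inner] at h1 h2 ⊢
    simp only [Prod.fst_add, Prod.snd_add, ContinuousMap.add_apply, inner_add_right]
    rw [h1, h2]
    ring
  zero_mem' := by
    intro x
    rw [integral_eq_inner]
    simp
  smul_mem' := by
    intro c a ha x
    have h1 := ha x
    rw [integral_eq_inner] at h1 ⊢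
    simp only [Prod.smul_fst, Prod.smul_snd, ContinuousMap.smul_apply, inner_smul_right,
      smul_eq_mul]
    rw [h1]
    ring

abbrev H1 : Type := H1Submodule

theorem isClosed_H1 : IsClosed (H1Submodule : Set (C(Icc (0 : ℝ) 1, ℝ) × L2)) := by
  have : (H1Submodule : Set (C(Icc (0 : ℝ) 1, ℝ) × L2)) =
      ⋂ x : Icc (0 : ℝ) 1, {f | f.1 x = f.1 0 +
        inner ℝ (indicatorConstLp 2 (μ := vol01) (measurableSet_Ioc (a := (0 : ℝ)) (b := x))
          (measure_ne_top _ _) (1 : ℝ)) f.2} := by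
    ext f
    simp only [SetLike.mem_coe, mem_iInter, mem_ofPred_eq, ← integral_eq_inner]
    rfl
  rw [this]
  refine isClosed_iInter fun x => isClosed_eq ?_ ?_
  · fun_prop
  · fun_prop

instance : CompleteSpace H1 := isClosed_H1.completeSpace_coe

/-- The value at `x ∈ [0,1]` of (the continuous representative of) an `H¹` function. -/
def H1.eval (f : H1) (x : ℝ) : ℝ := f.1.1 (projIcc 0 1 zero_le_one x)

/-- The weak derivative of an `H¹` function. -/
def H1.deriv (f : H1) : L2 := f.1.2

theorem H1.continuous_eval (x : ℝ) : Continuous fun f : H1 => f.eval x := by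
  unfold H1.eval
  fun_prop

/-- The space `𝓗` of the quadruples `(u, u_t, v, v_t) ∈ H¹ × L² × H¹ × L²` with `u(1) = v(0)`. -/
def stateSubmodule : Submodule ℝ (H1 × L2 × H1 × L2) where
  carrier := {z | z.1.eval 1 = z.2.2.1.eval 0}
  add_mem' := by
    intro a b ha hb
    exact congrArg₂ (fun r s : ℝ => r + s) ha hb
  zero_mem' := rfl
  smul_mem' := by
    intro c a ha
    exact congrArg (fun r : ℝ => c * r) ha

abbrev StateSpace : Type := stateSubmodule

theorem isClosed_stateSubmodule : IsClosed (stateSubmodule : Set (H1 × L2 × H1 × L2)) :=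
  isClosed_eq ((H1.continuous_eval 1).comp continuous_fst)
    ((H1.continuous_eval 0).comp (continuous_fst.comp (continuous_snd.comp continuous_snd)))

instance : CompleteSpace StateSpace := isClosed_stateSubmodule.completeSpace_coe

namespace StateSpace

/-- The component `u`. -/
def u (z : StateSpace) : H1 := z.1.1

/-- The component `u_t`. -/
def ut (z : StateSpace) : L2 := z.1.2.1

/-- The component `v`. -/
def v (z : StateSpace) : H1 := z.1.2.2.1

/-- The component `v_t`. -/
def vt (z : StateSpace) : L2 := z.1.2.2.2

/-- The seminorm `(c₁² ‖u_x‖² + ‖u_t‖² + c₂² ‖v_x‖² + ‖v_t‖²)^(1/2)` on `𝓗`. -/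
def seminorm (c₁ c₂ : ℝ) (z : StateSpace) : ℝ :=
  Real.sqrt (c₁ ^ 2 * ‖z.u.deriv‖ ^ 2 + ‖z.ut‖ ^ 2 + c₂ ^ 2 * ‖z.v.deriv‖ ^ 2 + ‖z.vt‖ ^ 2)

end StateSpace

/-! ### The closed loop -/

/-- `IsGenerator c₁ c₂ g h q Z Y` says that `Z = (u, p, v, r)` lies in the domain of the operator
`T (u, p, v, r) = (p, c₁² u_xx, r, c₂² v_xx)` of the closed loop and that `T Z = Y`. The domain
consists of the `Z ∈ 𝓗` with `u, v ∈ H²`, `p, r ∈ H¹`, `p(1) = r(0)` (this is `Y ∈ 𝓗`) and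
`u_x(0) = g p(0)`, `v_x(0) = u_x(1)`, `v_x(1) = -h r(1) - q v(1)`. -/
def IsGenerator (c₁ c₂ g h q : ℝ) (Z Y : StateSpace) : Prop :=
  Z.ut =ᵐ[vol01] Y.u.eval ∧ Z.vt =ᵐ[vol01] Y.v.eval ∧
  ∃ ux vx : H1,
    Z.u.deriv =ᵐ[vol01] ux.eval ∧ Z.v.deriv =ᵐ[vol01] vx.eval ∧
    Y.ut = c₁ ^ 2 • ux.deriv ∧ Y.vt = c₂ ^ 2 • vx.deriv ∧
    ux.eval 0 = g * Y.u.eval 0 ∧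
    vx.eval 0 = ux.eval 1 ∧
    vx.eval 1 = -h * Y.v.eval 1 - q * Z.v.eval 1

/-- Solutions of the closed loop with initial condition `z₀ ∈ 𝓗`, in the usual (mild) sense for
data of finite energy: `z ∈ C([0,∞); 𝓗)` and, for every `t ≥ 0`, the integral `∫₀ᵗ z(s) ds` lies in
the domain of `T` and `z(t) = z₀ + T ∫₀ᵗ z(s) ds`. -/
def IsSolution (c₁ c₂ g h q : ℝ) (z₀ : StateSpace) (z : ℝ → StateSpace) : Prop :=
  ContinuousOn z (Ici 0) ∧
  ∀ t : ℝ, 0 ≤ t → IsGenerator c₁ c₂ g h q (∫ s in (0 : ℝ)..t, z s) (z t - z₀)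

/-! ### The matrix inequality -/

def matH (c₁ c₂ g h q : ℝ) : Matrix (Fin 4) (Fin 5) ℝ :=
  !![0,          c₁,  1, 0,          0;
     1 - c₁ * g, 0,   0, 0,          0;
     0,          0,   0, 1 - c₂ * h, -c₂ * q;
     0,          -c₂, 1, 0,          0]

def matG (c₁ c₂ g h q : ℝ) : Matrix (Fin 4) (Fin 5) ℝ :=
  !![1 + c₁ * g, 0,   0, 0,          0;
     0,          -c₁, 1, 0,          0;
     0,          c₂,  1, 0,          0;
     0,          0,   0, 1 + c₂ * h, c₂ * q]

def matS (S₁ S₂ S₃ S₄ : ℝ) : Matrix (Fin 4) (Fin 4) ℝ :=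
  Matrix.diagonal ![S₁, S₂, S₃, S₄]

def matE (c₁ c₂ α x : ℝ) : Matrix (Fin 4) (Fin 4) ℝ :=
  Matrix.diagonal ![Real.exp (2 * α * x * c₁⁻¹), Real.exp (2 * α * x * c₁⁻¹),
    Real.exp (2 * α * x * c₂⁻¹), Real.exp (2 * α * x * c₂⁻¹)]

def matQ (α S₅ : ℝ) : Matrix (Fin 5) (Fin 5) ℝ :=
  !![0, 0, 0, 0,  0;
     0, 0, 0, 0,  0;
     0, 0, 0, 0,  0;
     0, 0, 0, 0,  S₅;
     0, 0, 0, S₅, 2 * α * S₅]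

/-- `Ψ(α) = Hᵀ E_α(1) S H - Gᵀ S G + Q_α`. -/
def matPsi (c₁ c₂ g h q S₁ S₂ S₃ S₄ S₅ α : ℝ) : Matrix (Fin 5) (Fin 5) ℝ :=
  (matH c₁ c₂ g h q).transpose * matE c₁ c₂ α 1 * matS S₁ S₂ S₃ S₄ * matH c₁ c₂ g h q
    - (matG c₁ c₂ g h q).transpose * matS S₁ S₂ S₃ S₄ * matG c₁ c₂ g h q
    + matQ α S₅

/-- `Ψ̃`: the matrix `Ψ(0)` without its last row and column. The entries of `Ψ(0)` that involve
`S₅` or `q` are among those removed (see `matPsi_submatrix`), so these are set to `0`. -/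
def matPsiTilde (c₁ c₂ g h S₁ S₂ S₃ S₄ : ℝ) : Matrix (Fin 4) (Fin 4) ℝ :=
  (matPsi c₁ c₂ g h 0 S₁ S₂ S₃ S₄ 0 0).submatrix Fin.castSucc Fin.castSucc

theorem matPsi_submatrix (c₁ c₂ g h q S₁ S₂ S₃ S₄ S₅ : ℝ) :
    (matPsi c₁ c₂ g h q S₁ S₂ S₃ S₄ S₅ 0).submatrix Fin.castSucc Fin.castSucc =
      matPsiTilde c₁ c₂ g h S₁ S₂ S₃ S₄ := by
  ext i j
  fin_cases i <;> fin_cases j <;>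
    simp [matPsiTilde, matPsi, matH, matG, matQ, matE, matS, Matrix.mul_apply, Fin.sum_univ_succ,
      Matrix.diagonal_apply]

end

end WaveLoop

/-!
In the Riemann coordinates `u_t ± c₁ u_x` and `v_t ± c₂ v_x` the closed loop consists of four
transport equations on the unit interval. At the two ends and at the junction, the coordinates that
enter the interval are linear functions of those that leave it. Parametrized by the velocities at
the three points and the slope at the junction, the incoming coordinates are `H y` and the outgoing
ones `G y`, so that `Ψ̃ ≺ 0` says that the incoming energy, weighted with the `Sᵢ`, is strictly
smaller than the outgoing one. By compactness the inequality survives the multiplication of the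
incoming energy with a factor slightly larger than `1` (`exists_one_add_mul_le`), which leaves room
for a rate `α > 0` (`exists_decayWeights`).

*Decay.* Weight the energy of each Riemann coordinate with an exponential that increases towards the
end where the coordinate enters. Integration by parts (`two_mul_wInner_deriv`) turns the energy
production into boundary terms, which have a sign by the choice of `α`, and `-2 α` times the energy
(`DecayWeights.energy_generator_le`). If `z` is a mild solution, then the increments `∫ₜᵗ⁺ᵉ z` are
classical solutions, and after division by `ε` they tend to `z t`; hence the energy decays along mild
solutions, too (`IsMildSolution.form_le`). The energy is equivalent to the square of the seminorm
of `𝓗`. The seminorm does not see constants, but `u` and `v` are recovered from `u_t` and `v_t`, so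
that solutions depend continuously on the initial state on bounded intervals
(`DecayWeights.stableOnBounded`). In particular they are unique.

*Existence.* If the Riemann coordinates of the initial state are continuous functions on `ℝ` that vanish
outside the open unit interval, then the d'Alembert formula is an explicit solution up to the time of
the shorter crossing, because until then every outgoing coordinate is known from the initial state
(`exists_isMildSolution_test`). This uses `1 + c₁ g ≠ 0` and `1 + c₂ h ≠ 0`, which follow from
`Ψ̃ ≺ 0`. Such states are dense, and since the generator is closed and solutions depend continuously
on the initial state, the states for which a solution exists form a closed set
(`StableOnBounded.isClosed_solvable`). So every state has a solution on an interval of fixed length,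
and solutions can be concatenated.
-/

namespace WaveLoop

open MeasureTheory Set Filter Topology

noncomputable section

/-! ### Mild solutions of linear evolution equations -/

section

variable {E : Type*} [NormedAddCommGroup E] [NormedSpace ℝ E]

/-- Mild solutions on `[0,T]` of `z' = A z`, `z 0 = z₀`, where `G` is the graph of the linear
operator `A`. Values outside `[0,T]` play no role; continuity on all of `ℝ` is no restriction, since
a continuous function on `[0,T]` has a continuous extension. -/
def IsMildSolution (G : Submodule ℝ (E × E)) (T : ℝ) (z₀ : E) (z : ℝ → E) : Prop :=
  Continuous z ∧ ∀ t ∈ Icc (0 : ℝ) T, (∫ s in (0 : ℝ)..t, z s, z t - z₀) ∈ G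

/-- A quadratic form `B z z` on `E`, given with its polar form `B`, which decays at the rate `2 α`
along classical solutions of `z' = A z`; `G` is the graph of `A`. -/
structure DissipativeForm (G : Submodule ℝ (E × E)) (α : ℝ) where
  B : E → E → ℝ
  smul_smul : ∀ (r : ℝ) (z : E), B (r • z) (r • z) = r ^ 2 * B z z
  continuous : Continuous fun z => B z z
  hasDerivAt : ∀ {D : ℝ → E} {D' : E} {t : ℝ}, HasDerivAt D D' t →
    HasDerivAt (fun s => B (D s) (D s)) (2 * B (D t) D') t
  dissipative : ∀ {z y : E}, (z, y) ∈ G → B z y ≤ -α * B z z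

variable {G : Submodule ℝ (E × E)} {α T : ℝ} {z₀ y₀ : E} {z y : ℝ → E}

namespace IsMildSolution

theorem mono {T' : ℝ} (hz : IsMildSolution G T z₀ z) (hT : T' ≤ T) : IsMildSolution G T' z₀ z :=
  ⟨hz.1, fun t ht => hz.2 t ⟨ht.1, ht.2.trans hT⟩⟩

theorem initial (hG : ∀ y, (0, y) ∈ G → y = 0) (hz : IsMildSolution G T z₀ z) (hT : 0 ≤ T) :
    z 0 = z₀ := by
  have h0 := hz.2 0 ⟨le_rfl, hT⟩
  rw [intervalIntegral.integral_same] at h0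
  exact sub_eq_zero.1 (hG _ h0)

theorem add [CompleteSpace E] (hz : IsMildSolution G T z₀ z) (hy : IsMildSolution G T y₀ y) :
    IsMildSolution G T (z₀ + y₀) (fun t => z t + y t) := by
  refine ⟨hz.1.add hy.1, fun t ht => ?_⟩
  rw [intervalIntegral.integral_add (hz.1.intervalIntegrable _ _) (hy.1.intervalIntegrable _ _),
    add_sub_add_comm]
  exact G.add_mem (hz.2 t ht) (hy.2 t ht)

theorem smul (r : ℝ) (hz : IsMildSolution G T z₀ z) :
    IsMildSolution G T (r • z₀) (fun t => r • z t) := by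
  refine ⟨hz.1.const_smul r, fun t ht => ?_⟩
  rw [intervalIntegral.integral_smul, ← smul_sub]
  exact G.smul_mem r (hz.2 t ht)

theorem sub [CompleteSpace E] (hz : IsMildSolution G T z₀ z) (hy : IsMildSolution G T y₀ y) :
    IsMildSolution G T (z₀ - y₀) (fun t => z t - y t) := by
  simpa only [neg_one_smul, ← sub_eq_add_neg] using hz.add (hy.smul (-1))

/-- Solutions can be concatenated. -/
theorem concat [CompleteSpace E] {T₁ T₂ : ℝ} (hT₁ : 0 ≤ T₁) (hz : IsMildSolution G T₁ z₀ z)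
    (hy : IsMildSolution G T₂ (z T₁) y) (hy0 : y 0 = z T₁) :
    IsMildSolution G (T₁ + T₂) z₀ (fun t => if t ≤ T₁ then z t else y (t - T₁)) := by
  set w : ℝ → E := fun t => if t ≤ T₁ then z t else y (t - T₁) with hw
  have hwc : Continuous w := by
    refine Continuous.if_le hz.1 (hy.1.comp (continuous_id.sub continuous_const)) continuous_id
      continuous_const fun t ht => ?_
    simp [ht, hy0]
  have hleft : ∀ t, 0 ≤ t → t ≤ T₁ → ∫ s in (0 : ℝ)..t, w s = ∫ s in (0 : ℝ)..t, z s := by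
    intro t h0 ht
    refine intervalIntegral.integral_congr fun s hs => ?_
    rw [uIcc_of_le h0] at hs
    exact if_pos (hs.2.trans ht)
  refine ⟨hwc, fun t ht => ?_⟩
  rcases le_or_gt t T₁ with h1 | h1
  · rw [hleft t ht.1 h1, hw]
    simp only [if_pos h1]
    exact hz.2 t ⟨ht.1, h1⟩
  · have hright : ∫ s in T₁..t, w s = ∫ s in (0 : ℝ)..t - T₁, y s := by
      rw [← sub_self T₁, ← intervalIntegral.integral_comp_sub_right]
      refine intervalIntegral.integral_congr fun s hs => ?_
      rw [uIcc_of_le h1.le] at hs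
      rcases hs.1.eq_or_lt with rfl | h2
      · simp [hw, hy0]
      · exact if_neg h2.not_ge
    rw [← intervalIntegral.integral_add_adjacent_intervals (hwc.intervalIntegrable 0 T₁)
      (hwc.intervalIntegrable T₁ t), hright, hleft T₁ hT₁ le_rfl]
    have e1 := hz.2 T₁ ⟨hT₁, le_rfl⟩
    have e2 := hy.2 (t - T₁) ⟨by linarith, by linarith [ht.2]⟩
    have e3 := G.add_mem e1 e2
    rw [Prod.mk_add_mk, add_comm (z T₁ - z₀), sub_add_sub_cancel] at e3
    rw [hw]
    simpa only [if_neg h1.not_ge] using e3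

/-- A solution on `[0,∞)` restricts to a solution on each bounded interval. -/
theorem of_continuousOn {z : ℝ → E} (hz : ContinuousOn z (Ici 0))
    (hzG : ∀ t, 0 ≤ t → (∫ s in (0 : ℝ)..t, z s, z t - z₀) ∈ G) :
    IsMildSolution G T z₀ fun t => z (max t 0) := by
  refine ⟨hz.comp_continuous (by fun_prop) fun t => le_max_right t 0, fun t ht => ?_⟩
  have : ∫ s in (0 : ℝ)..t, z (max s 0) = ∫ s in (0 : ℝ)..t, z s := by
    refine intervalIntegral.integral_congr fun s hs => ?_
    rw [uIcc_of_le ht.1] at hs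
    exact congrArg z (max_eq_left hs.1)
  simp only [this, max_eq_left ht.1]
  exact hzG t ht.1

variable [CompleteSpace E]

theorem hasDerivAt_integral (hz : IsMildSolution G T z₀ z) (s : ℝ) :
    HasDerivAt (fun s => ∫ r in (0 : ℝ)..s, z r) (z s) s :=
  (hz.1.integral_hasStrictDerivAt 0 s).hasDerivAt

/-- Decay of the form on the increment `∫ₜᵗ⁺ᵉ z`. The increment is a classical solution, so that the
dissipation inequality applies to it. -/
theorem form_increment_le (W : DissipativeForm G α) (hz : IsMildSolution G T z₀ z)
    {t ε : ℝ} (ht : 0 ≤ t) (hε : 0 ≤ ε) (htε : t + ε ≤ T) :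
    let D := fun s => (∫ r in (0 : ℝ)..s + ε, z r) - ∫ r in (0 : ℝ)..s, z r
    W.B (D t) (D t) ≤ Real.exp (-2 * α * t) * W.B (D 0) (D 0) := by
  intro D
  have hD (s : ℝ) : HasDerivAt D (z (s + ε) - z s) s :=
    ((hz.hasDerivAt_integral (s + ε)).comp_add_const s ε).sub (hz.hasDerivAt_integral s)
  have hgen (s : ℝ) (hs : s ∈ Icc 0 t) : (D s, z (s + ε) - z s) ∈ G := by
    have h1 := hz.2 (s + ε) ⟨by linarith [hs.1], by linarith [hs.2]⟩
    have h2 := hz.2 s ⟨hs.1, by linarith [hs.2]⟩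
    have h3 := G.sub_mem h1 h2
    rwa [Prod.mk_sub_mk, sub_sub_sub_cancel_right] at h3
  have hφ (s : ℝ) : HasDerivAt (fun s => Real.exp (2 * α * s) * W.B (D s) (D s))
      (Real.exp (2 * α * s) * (2 * α) * W.B (D s) (D s) +
        Real.exp (2 * α * s) * (2 * W.B (D s) (z (s + ε) - z s))) s := by
    have he : HasDerivAt (fun s => Real.exp (2 * α * s)) (Real.exp (2 * α * s) * (2 * α)) s := by
      simpa using ((hasDerivAt_id s).const_mul (2 * α)).exp
    exact he.fun_mul (W.hasDerivAt (hD s))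
  have hanti : AntitoneOn (fun s => Real.exp (2 * α * s) * W.B (D s) (D s)) (Icc 0 t) := by
    refine antitoneOn_of_deriv_nonpos (convex_Icc 0 t)
      (fun s _ => (hφ s).continuousAt.continuousWithinAt)
      (fun s _ => (hφ s).differentiableAt.differentiableWithinAt) fun s hs => ?_
    rw [(hφ s).deriv]
    have h1 := W.dissipative (hgen s (interior_subset hs))
    have h2 := Real.exp_pos (2 * α * s)
    nlinarith
  have h1 := hanti (left_mem_Icc.2 ht) (right_mem_Icc.2 ht) ht
  simp only [mul_zero, Real.exp_zero, one_mul] at h1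
  have h2 : Real.exp (-2 * α * t) * Real.exp (2 * α * t) = 1 := by
    rw [← Real.exp_add, neg_mul, neg_mul, neg_add_cancel, Real.exp_zero]
  calc W.B (D t) (D t)
      = Real.exp (-2 * α * t) * (Real.exp (2 * α * t) * W.B (D t) (D t)) := by
        rw [← mul_assoc, h2, one_mul]
    _ ≤ _ := mul_le_mul_of_nonneg_left h1 (Real.exp_pos _).le

/-- Exponential decay of a dissipative form along mild solutions. -/
theorem form_le (hG : ∀ y, (0, y) ∈ G → y = 0) (W : DissipativeForm G α)
    (hz : IsMildSolution G T z₀ z) {t : ℝ} (ht : t ∈ Icc 0 T) :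
    W.B (z t) (z t) ≤ Real.exp (-2 * α * t) * W.B z₀ z₀ := by
  rcases eq_or_ne T 0 with rfl | hT
  · obtain rfl : t = 0 := le_antisymm ht.2 ht.1
    simp [hz.initial hG le_rfl]
  have hT0 : (0 : ℝ) < T := lt_of_le_of_ne (ht.1.trans ht.2) hT.symm
  have hIco : ∀ s ∈ Ico 0 T, W.B (z s) (z s) ≤ Real.exp (-2 * α * s) * W.B z₀ z₀ := by
    intro s hs
    -- `z s` is the limit of the difference quotients of `∫₀ z`.
    have lim (r : ℝ) := (hz.hasDerivAt_integral r).tendsto_slope_zero_right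
    have h1 := (W.continuous.tendsto _).comp (lim s)
    have h2 := ((W.continuous.tendsto _).comp (lim 0)).const_mul (Real.exp (-2 * α * s))
    rw [hz.initial hG hT0.le] at h2
    refine le_of_tendsto_of_tendsto h1 h2 ?_
    filter_upwards [Ioo_mem_nhdsGT (sub_pos.2 hs.2)] with ε hε
    have := hz.form_increment_le W hs.1 hε.1.le (by linarith [hε.2] : s + ε ≤ T)
    simp only [Function.comp_apply, W.smul_smul]
    rw [mul_left_comm]
    exact mul_le_mul_of_nonneg_left this (sq_nonneg _)
  have hcl : closure (Ico 0 T) = Icc 0 T := closure_Ico hT0.ne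
  refine le_on_closure hIco (W.continuous.comp hz.1).continuousOn ?_ (hcl ▸ ht)
  fun_prop

end IsMildSolution

/-- Mild solutions on bounded intervals depend continuously on the initial state. -/
def StableOnBounded (G : Submodule ℝ (E × E)) : Prop :=
  ∀ T : ℝ, 0 ≤ T → ∃ C : ℝ, 0 ≤ C ∧ ∀ (z₀ : E) (z : ℝ → E),
    IsMildSolution G T z₀ z → ∀ t ∈ Icc 0 T, ‖z t‖ ≤ C * ‖z₀‖

variable [CompleteSpace E]

namespace StableOnBounded

theorem unique (hS : StableOnBounded G) (hz : IsMildSolution G T z₀ z)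
    (hy : IsMildSolution G T z₀ y) {t : ℝ} (ht : t ∈ Icc 0 T) : z t = y t := by
  obtain ⟨C, -, hC⟩ := hS T (ht.1.trans ht.2)
  have := hC _ _ (hz.sub hy) t ht
  rw [sub_self, norm_zero, mul_zero] at this
  exact sub_eq_zero.1 (norm_le_zero_iff.1 this)

/-- If the graph is closed and solutions depend continuously on the initial state, then the set of
the initial states for which there is a solution is closed. -/
theorem isClosed_solvable (hS : StableOnBounded G) (hG : IsClosed (G : Set (E × E))) (hT : 0 ≤ T) :
    IsClosed {z₀ : E | ∃ z, IsMildSolution G T z₀ z} := by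
  obtain ⟨C, hC0, hC⟩ := hS T hT
  refine IsSeqClosed.isClosed fun x a hx hxa => ?_
  choose z hz using hx
  let ζ : ℕ → C(Icc (0 : ℝ) T, E) := fun n => ⟨fun t => z n t, (hz n).1.comp continuous_subtype_val⟩
  have hdist (m n : ℕ) : dist (ζ m) (ζ n) ≤ C * dist (x m) (x n) := by
    refine (ContinuousMap.dist_le (by positivity)).2 fun t => ?_
    rw [dist_eq_norm, dist_eq_norm]
    exact hC _ _ ((hz m).sub (hz n)) t t.2
  have hcau : CauchySeq ζ := by
    refine Metric.cauchySeq_iff.2 fun ε hε => ?_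
    obtain ⟨N, hN⟩ := Metric.cauchySeq_iff.1 hxa.cauchySeq (ε / (C + 1)) (by positivity)
    refine ⟨N, fun m hm n hn => (hdist m n).trans_lt ?_⟩
    have h1 := (lt_div_iff₀ (by positivity : 0 < C + 1)).1 (hN m hm n hn)
    have h2 := dist_nonneg (x := x m) (y := x n)
    linarith
  obtain ⟨η, hη⟩ := cauchySeq_tendsto_of_complete hcau
  refine ⟨fun t => η (projIcc 0 T hT t), η.continuous.comp continuous_projIcc, fun t ht => ?_⟩
  have hpt : ∀ s ∈ Icc 0 T, Tendsto (fun n => z n s) atTop (𝓝 (η (projIcc 0 T hT s))) := by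
    intro s hs
    rw [projIcc_of_mem hT hs]
    exact ((continuous_eval_const (F := C(Icc (0 : ℝ) T, E)) ⟨s, hs⟩).tendsto η).comp hη
  have hint : Tendsto (fun n => ∫ s in (0 : ℝ)..t, z n s) atTop
      (𝓝 (∫ s in (0 : ℝ)..t, η (projIcc 0 T hT s))) := by
    have hηc : Continuous fun s => η (projIcc 0 T hT s) := η.continuous.comp continuous_projIcc
    rw [tendsto_iff_norm_sub_tendsto_zero]
    have h0 : Tendsto (fun n => dist (ζ n) η * |t - 0|) atTop (𝓝 0) := by
      simpa using (tendsto_iff_dist_tendsto_zero.1 hη).mul_const |t - 0|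
    refine squeeze_zero (fun _ => norm_nonneg _) (fun n => ?_) h0
    rw [← intervalIntegral.integral_sub ((hz n).1.intervalIntegrable _ _)
      (hηc.intervalIntegrable _ _)]
    refine intervalIntegral.norm_integral_le_of_norm_le_const fun s hs => ?_
    rw [uIoc_of_le ht.1] at hs
    have hs' : s ∈ Icc 0 T := ⟨hs.1.le, hs.2.trans ht.2⟩
    rw [projIcc_of_mem hT hs', ← dist_eq_norm]
    exact ContinuousMap.dist_apply_le_dist (f := ζ n) (g := η) ⟨s, hs'⟩
  exact hG.mem_of_tendsto (hint.prodMk_nhds ((hpt t ht).sub hxa))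
    (Eventually.of_forall fun n => (hz n).2 t ht)

/-- Solutions for all initial states on one interval give solutions on all bounded intervals. -/
theorem exists_of_exists (hG : ∀ y, (0, y) ∈ G → y = 0) {τ : ℝ} (hτ : 0 < τ)
    (hex : ∀ z₀ : E, ∃ z, IsMildSolution G τ z₀ z) (T : ℝ) (z₀ : E) :
    ∃ z, IsMildSolution G T z₀ z := by
  have hn : ∀ n : ℕ, ∃ z, IsMildSolution G (n * τ) z₀ z := by
    intro n
    induction n with
    | zero =>
      obtain ⟨z, hz⟩ := hex z₀
      exact ⟨z, hz.mono (by simpa using hτ.le)⟩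
    | succ n ih =>
      obtain ⟨z, hz⟩ := ih
      obtain ⟨y, hy⟩ := hex (z (n * τ))
      have := hz.concat (by positivity) hy (hy.initial hG hτ.le)
      exact ⟨_, this.mono (by push_cast; linarith)⟩
  obtain ⟨n, hn'⟩ := exists_nat_ge (T / τ)
  obtain ⟨z, hz⟩ := hn n
  exact ⟨z, hz.mono ((div_le_iff₀ hτ).1 hn')⟩

/-- Solutions on all bounded intervals fit together. -/
theorem exists_global (hS : StableOnBounded G) (z₀ : E)
    (hex : ∀ T : ℝ, ∃ z, IsMildSolution G T z₀ z) :
    ∃ z : ℝ → E, ContinuousOn z (Ici 0) ∧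
      (∀ t, 0 ≤ t → (∫ s in (0 : ℝ)..t, z s, z t - z₀) ∈ G) ∧
      ∀ T, 0 ≤ T → ∃ y, IsMildSolution G T z₀ y ∧ ∀ t ∈ Icc 0 T, z t = y t := by
  choose y hy using hex
  have heq : ∀ T, ∀ t ∈ Icc 0 T, y t t = y T t := fun T t ht =>
    hS.unique (hy t) ((hy T).mono ht.2) ⟨ht.1, le_rfl⟩
  refine ⟨fun t => y t t, fun t ht => ?_, fun t ht => ?_, fun T _ => ⟨y T, hy T, heq T⟩⟩
  · refine ((hy (t + 1)).1.continuousWithinAt (s := Ici 0) (x := t)).congr_of_eventuallyEq ?_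
      (heq _ t ⟨ht, by linarith⟩)
    filter_upwards [self_mem_nhdsWithin, mem_nhdsWithin_of_mem_nhds (Iio_mem_nhds (lt_add_one t))]
      with s hs hs'
    exact heq _ s ⟨hs, le_of_lt hs'⟩
  · have : ∫ s in (0 : ℝ)..t, y s s = ∫ s in (0 : ℝ)..t, y t s := by
      refine intervalIntegral.integral_congr fun s hs => ?_
      rw [uIcc_of_le ht] at hs
      exact heq t s hs
    rw [this]
    exact (hy t).2 t ⟨ht, le_rfl⟩

end StableOnBounded

end

/-! ### The spaces `L²` and `H¹` on the unit interval -/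

instance : IsProbabilityMeasure vol01 := ⟨by simp⟩

/-- The `L²` class of a continuous function on `[0,1]`, as a linear map. -/
def contToL2Lin : C(Icc (0 : ℝ) 1, ℝ) →ₗ[ℝ] L2 where
  toFun f := BoundedContinuousFunction.toLp 2 vol01 ℝ
    ((BoundedContinuousFunction.mkOfCompact f).compContinuous
      ⟨projIcc (0 : ℝ) 1 zero_le_one, continuous_projIcc⟩)
  map_add' f g := by rw [← map_add]; rfl
  map_smul' c f := by rw [RingHom.id_apply, ← map_smul]; rfl

theorem contToL2Lin_ae (f : C(Icc (0 : ℝ) 1, ℝ)) :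
    contToL2Lin f =ᵐ[vol01] fun x => f (projIcc 0 1 zero_le_one x) :=
  BoundedContinuousFunction.coeFn_toLp (p := 2) (𝕜 := ℝ) (μ := vol01) _

theorem norm_contToL2Lin_le (f : C(Icc (0 : ℝ) 1, ℝ)) : ‖contToL2Lin f‖ ≤ 1 * ‖f‖ := by
  refine (Lp.norm_le_of_ae_bound (C := ‖f‖) (norm_nonneg _) ?_).trans ?_
  · filter_upwards [contToL2Lin_ae f] with x hx
    rw [hx]
    exact f.norm_coe_le_norm _
  · simp [measureUnivNNReal]

/-- The `L²` class of a continuous function on `[0,1]`. -/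
def contToL2 : C(Icc (0 : ℝ) 1, ℝ) →L[ℝ] L2 :=
  contToL2Lin.mkContinuous 1 norm_contToL2Lin_le

theorem contToL2_ae (f : C(Icc (0 : ℝ) 1, ℝ)) :
    contToL2 f =ᵐ[vol01] fun x => f (projIcc 0 1 zero_le_one x) :=
  contToL2Lin_ae f

theorem norm_contToL2_le (f : C(Icc (0 : ℝ) 1, ℝ)) : ‖contToL2 f‖ ≤ ‖f‖ :=
  (norm_contToL2Lin_le f).trans_eq (one_mul _)

theorem ae_mem_Icc : ∀ᵐ x ∂vol01, x ∈ Icc (0 : ℝ) 1 := ae_restrict_mem measurableSet_Icc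

theorem intervalIntegrable_coe (w : L2) : IntervalIntegrable w volume 0 1 := by
  rw [intervalIntegrable_iff_integrableOn_Icc_of_le zero_le_one]
  exact (Lp.memLp w).integrable one_le_two

/-- Integrals over `[0,1]` with respect to `vol01` as interval integrals. -/
theorem integral_vol01 (f : ℝ → ℝ) : ∫ x, f x ∂vol01 = ∫ x in (0 : ℝ)..1, f x := by
  rw [intervalIntegral.integral_of_le zero_le_one, integral_Icc_eq_integral_Ioc]

theorem norm_primitive_le (w : L2) (x : Icc (0 : ℝ) 1) : |∫ y in (0 : ℝ)..x, w y| ≤ ‖w‖ := by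
  rw [integral_eq_inner]
  refine (abs_real_inner_le_norm _ _).trans ?_
  refine mul_le_of_le_one_left (norm_nonneg _) ?_
  rw [norm_indicatorConstLp (by norm_num) (by norm_num)]
  simp only [norm_one, one_mul]
  exact Real.rpow_le_one measureReal_nonneg measureReal_le_one (by norm_num)

theorem continuous_primitive (w : L2) :
    Continuous fun x : Icc (0 : ℝ) 1 => ∫ y in (0 : ℝ)..x, w y := by
  have h := intervalIntegral.continuousOn_primitive_interval (μ := volume) (f := w) (a := 0)
    (b := 1) ((uIcc_of_le (zero_le_one (α := ℝ))).symm ▸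
      (Lp.memLp w).integrable one_le_two)
  rw [uIcc_of_le zero_le_one] at h
  exact continuousOn_iff_continuous_domRestrict.1 h

/-- The primitive `x ↦ ∫₀ˣ w` of an `L²` function, as a continuous function on `[0,1]`. -/
def primitive : L2 →L[ℝ] C(Icc (0 : ℝ) 1, ℝ) :=
  LinearMap.mkContinuous
    { toFun := fun w => ⟨fun x => ∫ y in (0 : ℝ)..x, w y, continuous_primitive w⟩
      map_add' := fun a b => by
        ext x
        simp only [ContinuousMap.coe_mk, ContinuousMap.add_apply, integral_eq_inner,
          inner_add_right]
      map_smul' := fun c a => by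
        ext x
        simp only [ContinuousMap.coe_mk, ContinuousMap.smul_apply, integral_eq_inner,
          inner_smul_right, RingHom.id_apply, smul_eq_mul] }
    1 fun w => by
      rw [one_mul]
      exact (ContinuousMap.norm_le _ (norm_nonneg _)).2 fun x => norm_primitive_le w x

theorem primitive_apply (w : L2) (x : Icc (0 : ℝ) 1) :
    primitive w x = ∫ y in (0 : ℝ)..x, w y := rfl

namespace H1

/-- The weak derivative as a continuous linear map. -/
def derivL : H1 →L[ℝ] L2 := (ContinuousLinearMap.snd ℝ _ _).comp H1Submodule.subtypeL

/-- The inclusion `H¹ → L²`. -/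
def toL2 : H1 →L[ℝ] L2 :=
  contToL2.comp ((ContinuousLinearMap.fst ℝ _ _).comp H1Submodule.subtypeL)

/-- Point evaluation as a continuous linear functional. -/
def evalL (x : ℝ) : H1 →L[ℝ] ℝ :=
  (ContinuousMap.evalCLM ℝ (projIcc 0 1 zero_le_one x)).comp
    ((ContinuousLinearMap.fst ℝ _ _).comp H1Submodule.subtypeL)

theorem toL2_ae (f : H1) : toL2 f =ᵐ[vol01] f.eval := contToL2_ae f.1.1

theorem ae_eq_eval_iff {w : L2} {f : H1} : w =ᵐ[vol01] f.eval ↔ w = toL2 f :=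
  ⟨fun h => Lp.ext (h.trans (toL2_ae f).symm), fun h => h ▸ toL2_ae f⟩

theorem projIcc_zero : projIcc (0 : ℝ) 1 zero_le_one 0 = 0 := projIcc_left (h := zero_le_one)

theorem eval_eq (f : H1) {x : ℝ} (hx : x ∈ Icc (0 : ℝ) 1) :
    f.eval x = f.eval 0 + ∫ y in (0 : ℝ)..x, f.deriv y := by
  have h := f.2 ⟨x, hx⟩
  simp only [eval, projIcc_zero, projIcc_of_mem zero_le_one hx]
  exact h

theorem ext_eval {f f' : H1} (h : ∀ x ∈ Icc (0 : ℝ) 1, f.eval x = f'.eval x)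
    (hd : f.deriv = f'.deriv) : f = f' := by
  refine Subtype.ext (Prod.ext (ContinuousMap.ext fun x => ?_) hd)
  have := h x x.2
  simpa [eval] using this

/-- An `H¹` function is determined by its value at `0` and its derivative. -/
theorem ext_zero {f f' : H1} (h : f.eval 0 = f'.eval 0) (hd : f.deriv = f'.deriv) : f = f' :=
  ext_eval (fun x hx => by rw [eval_eq f hx, eval_eq f' hx, h, hd]) hd

/-- The `H¹` function with value `k` at `0` and derivative `w`. -/
def ofDeriv : ℝ × L2 →L[ℝ] H1 :=
  (((ContinuousLinearMap.fst ℝ ℝ L2).smulRight (1 : C(Icc (0 : ℝ) 1, ℝ)) +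
      primitive.comp (ContinuousLinearMap.snd ℝ ℝ L2)).prod
    (ContinuousLinearMap.snd ℝ ℝ L2)).codRestrict H1Submodule fun kw x => by
      simp [primitive_apply]

theorem ofDeriv_apply (kw : ℝ × L2) (x : Icc (0 : ℝ) 1) :
    (ofDeriv kw).1.1 x = kw.1 + ∫ y in (0 : ℝ)..x, kw.2 y := by
  change kw.1 • (1 : ℝ) + primitive kw.2 x = _
  rw [smul_eq_mul, mul_one, primitive_apply]

theorem ofDeriv_deriv (kw : ℝ × L2) : (ofDeriv kw).deriv = kw.2 := rfl

theorem ofDeriv_eval_zero (kw : ℝ × L2) : (ofDeriv kw).eval 0 = kw.1 := by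
  rw [eval, projIcc_zero, ofDeriv_apply]
  simp

theorem ofDeriv_eval_deriv (f : H1) : ofDeriv (f.eval 0, f.deriv) = f :=
  ext_zero (ofDeriv_eval_zero _) rfl

theorem norm_toL2_const (k : ℝ) : ‖toL2 (ofDeriv (k, 0))‖ = |k| := by
  have h : toL2 (ofDeriv (k, 0)) = Lp.const 2 vol01 k := by
    refine Lp.ext ((toL2_ae _).trans ?_)
    filter_upwards [ae_mem_Icc, Lp.coeFn_const 2 vol01 k, Lp.coeFn_zero ℝ 2 vol01]
      with x hx h1 h2
    rw [h1, eval_eq _ hx, ofDeriv_eval_zero, ofDeriv_deriv, integral_eq_inner 0 ⟨x, hx⟩]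
    simp
  rw [h]
  refine (Lp.norm_const' (p := 2) (μ := vol01) k (by norm_num) (by norm_num)).trans ?_
  simp

/-- The value at `0` is controlled by the `L²` norms of the function and of its derivative. -/
theorem abs_eval_zero_le (f : H1) : |f.eval 0| ≤ ‖toL2 f‖ + ‖f.deriv‖ := by
  have h : toL2 (ofDeriv (f.eval 0, 0)) = toL2 f - toL2 (ofDeriv (0, f.deriv)) := by
    conv_rhs => rw [← ofDeriv_eval_deriv f, ← map_sub, ← map_sub, ofDeriv_deriv]
    simp
  rw [← norm_toL2_const, h]
  refine (norm_sub_le _ _).trans ?_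
  gcongr
  refine (norm_contToL2_le _).trans ?_
  refine (ContinuousMap.norm_le _ (norm_nonneg _)).2 fun x => ?_
  have : (ofDeriv (0, f.deriv)).1.1 x = ∫ y in (0 : ℝ)..x, f.deriv y := by
    rw [ofDeriv_apply, zero_add]
  erw [this]
  exact norm_primitive_le _ x

/-- The `H¹` norm is controlled by the `L²` norms of the function and of its derivative. -/
theorem norm_le (f : H1) : ‖f‖ ≤ ‖toL2 f‖ + 2 * ‖f.deriv‖ := by
  have h0 := norm_nonneg (toL2 f)
  have h1 := norm_nonneg f.deriv
  refine max_le ((ContinuousMap.norm_le _ (by positivity)).2 fun x => ?_) ?_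
  · have h := eval_eq f x.2
    rw [eval, projIcc_val] at h
    refine (congrArg _ h).trans_le ((norm_add_le _ _).trans ?_)
    have := norm_primitive_le f.deriv x
    have := abs_eval_zero_le f
    simp only [Real.norm_eq_abs]
    linarith
  · change ‖f.deriv‖ ≤ _
    linarith

theorem ae_hasDerivAt (f : H1) :
    ∀ᵐ x, x ∈ Icc (0 : ℝ) 1 →
      HasDerivAt (fun x => f.eval 0 + ∫ y in (0 : ℝ)..x, f.deriv y) (f.deriv x) x := by
  filter_upwards [(intervalIntegrable_coe f.deriv).ae_hasDerivAt_integral] with x hx h01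
  rw [uIcc_of_le zero_le_one] at hx
  exact (hx h01 0 ⟨le_rfl, zero_le_one⟩).const_add _

/-- The inclusion `H¹ → L²` is injective. -/
theorem eq_zero_of_toL2_eq_zero {f : H1} (h : toL2 f = 0) : f = 0 := by
  have hF : ∀ x ∈ Icc (0 : ℝ) 1, f.eval x = 0 := by
    have hc : Continuous f.eval := f.1.1.continuous.comp continuous_projIcc
    have hae : f.eval =ᵐ[volume.restrict (Icc 0 1)] fun _ => (0 : ℝ) := by
      filter_upwards [toL2_ae f, Lp.coeFn_zero ℝ 2 vol01] with x h1 h2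
      rw [← h1, h, h2, Pi.zero_apply]
    exact Measure.eqOn_Icc_of_ae_eq volume zero_ne_one hae hc.continuousOn continuousOn_const
  refine ext_eval hF (Lp.ext ?_)
  refine EventuallyEq.trans ?_ (Lp.coeFn_zero ℝ 2 vol01).symm
  have h0 : ∀ᵐ x : ℝ, x ≠ 0 := by simp [ae_iff, measure_singleton]
  have h1 : ∀ᵐ x : ℝ, x ≠ 1 := by simp [ae_iff, measure_singleton]
  filter_upwards [ae_mem_Icc, ae_restrict_of_ae (ae_hasDerivAt f), ae_restrict_of_ae h0,
    ae_restrict_of_ae h1] with x hx hd h0 h1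
  have hloc : (fun x => f.eval 0 + ∫ y in (0 : ℝ)..x, f.deriv y) =ᶠ[𝓝 x] fun _ => 0 := by
    filter_upwards [Ioo_mem_nhds (lt_of_le_of_ne hx.1 h0.symm) (lt_of_le_of_ne hx.2 h1)] with y hy
    rw [← eval_eq f (Ioo_subset_Icc_self hy), hF y (Ioo_subset_Icc_self hy)]
  exact (hd hx).unique ((hasDerivAt_const x (0 : ℝ)).congr_of_eventuallyEq hloc)

end H1

/-! ### Weighted inner products and test functions -/

theorem exp_mul_le {β x : ℝ} (hx : x ∈ Icc (0 : ℝ) 1) : Real.exp (β * x) ≤ Real.exp |β| := by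
  refine Real.exp_le_exp.2 ?_
  calc β * x ≤ |β| * x := mul_le_mul_of_nonneg_right (le_abs_self β) hx.1
    _ ≤ |β| := mul_le_of_le_one_right (abs_nonneg β) hx.2

theorem memLp_exp (β : ℝ) : MemLp (fun x => Real.exp (β * x)) ⊤ vol01 := by
  refine memLp_top_of_bound (by fun_prop) (Real.exp |β|) ?_
  filter_upwards [ae_mem_Icc] with x hx
  rw [Real.norm_of_nonneg (Real.exp_pos _).le]
  exact exp_mul_le hx

/-- Multiplication by the weight `x ↦ exp (β x)` on `L²`. -/
def mulExp (β : ℝ) : L2 →L[ℝ] L2 :=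
  (ContinuousLinearMap.mul ℝ ℝ).holderL vol01 ⊤ 2 2 (memLp_exp β).toLp

theorem mulExp_ae (β : ℝ) (f : L2) : mulExp β f =ᵐ[vol01] fun x => Real.exp (β * x) * f x := by
  filter_upwards [ContinuousLinearMap.coeFn_holder (r := 2) (ContinuousLinearMap.mul ℝ ℝ)
    (memLp_exp β).toLp f, (memLp_exp β).coeFn_toLp] with x h1 h2
  rw [← h2]
  exact h1

/-- The weighted inner product `∫₀¹ exp (β x) f g`. -/
def wInner (β : ℝ) (f f' : L2) : ℝ := inner ℝ f (mulExp β f')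

theorem wInner_eq_integral (β : ℝ) (f f' : L2) :
    wInner β f f' = ∫ x in (0 : ℝ)..1, Real.exp (β * x) * (f x * f' x) := by
  rw [wInner, L2.inner_def, ← integral_vol01]
  refine integral_congr_ae ?_
  filter_upwards [mulExp_ae β f'] with x hx
  rw [hx]
  simp
  ring

theorem wInner_comm (β : ℝ) (f f' : L2) : wInner β f f' = wInner β f' f := by
  simp only [wInner_eq_integral, mul_comm]

theorem integral_sq_eq_norm_sq (f : L2) : ∫ x, f x * f x ∂vol01 = ‖f‖ ^ 2 := by
  rw [← real_inner_self_eq_norm_sq, L2.inner_def]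
  rfl

theorem integrable_sq (f : L2) : Integrable (fun x => f x * f x) vol01 :=
  L2.integrable_inner (𝕜 := ℝ) f f

theorem integrable_exp_sq (β : ℝ) (f : L2) :
    Integrable (fun x => Real.exp (β * x) * (f x * f x)) vol01 := by
  refine (L2.integrable_inner (𝕜 := ℝ) f (mulExp β f)).congr ?_
  filter_upwards [mulExp_ae β f] with x hx
  rw [hx]
  simp
  ring

theorem wInner_self_le (β : ℝ) (f : L2) : wInner β f f ≤ Real.exp |β| * ‖f‖ ^ 2 := by
  rw [wInner_eq_integral, ← integral_vol01, ← integral_sq_eq_norm_sq, ← integral_const_mul]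
  refine integral_mono_ae (integrable_exp_sq β f) ((integrable_sq f).const_mul _) ?_
  filter_upwards [ae_mem_Icc] with x hx
  exact mul_le_mul_of_nonneg_right (exp_mul_le hx) (mul_self_nonneg _)

theorem le_wInner_self (β : ℝ) (f : L2) : Real.exp (-|β|) * ‖f‖ ^ 2 ≤ wInner β f f := by
  rw [wInner_eq_integral, ← integral_vol01, ← integral_sq_eq_norm_sq, ← integral_const_mul]
  refine integral_mono_ae ((integrable_sq f).const_mul _) (integrable_exp_sq β f) ?_
  filter_upwards [ae_mem_Icc] with x hx
  refine mul_le_mul_of_nonneg_right (Real.exp_le_exp.2 ?_) (mul_self_nonneg _)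
  have h1 := neg_abs_le β
  have h2 := abs_nonneg β
  nlinarith [hx.1, hx.2]

/-- Weighted integration by parts, `2 ∫ e f f' = [e f²]₀¹ - ∫ e' f²` for `e x = exp (β x)`. -/
theorem two_mul_wInner_deriv (β : ℝ) (f : H1) :
    2 * wInner β (H1.toL2 f) f.deriv =
      Real.exp β * f.eval 1 ^ 2 - f.eval 0 ^ 2 - β * wInner β (H1.toL2 f) (H1.toL2 f) := by
  set F : ℝ → ℝ := fun x => f.eval 0 + ∫ y in (0 : ℝ)..x, f.deriv y with hF
  have hFeval : ∀ x ∈ Icc (0 : ℝ) 1, F x = f.eval x := fun x hx => (H1.eval_eq f hx).symm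
  have hFac : AbsolutelyContinuousOnInterval F 0 1 := by
    have h1 : AbsolutelyContinuousOnInterval (fun _ : ℝ => f.eval 0) 0 1 :=
      (contDiff_const (𝕜 := ℝ) (n := 1)).contDiffOn.absolutelyContinuousOnInterval
    exact h1.add ((intervalIntegrable_coe f.deriv).absolutelyContinuousOnInterval_intervalIntegral
      (by simp))
  have hE : AbsolutelyContinuousOnInterval (fun x => Real.exp (β * x)) 0 1 := by
    refine ContDiffOn.absolutelyContinuousOnInterval ?_
    exact (by fun_prop : ContDiff ℝ 1 fun x => Real.exp (β * x)).contDiffOn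
  have hftc := (hE.fun_mul (hFac.fun_mul hFac)).integral_deriv_eq_sub
  have h0 : f.eval 0 = F 0 := (hFeval 0 ⟨le_rfl, zero_le_one⟩).symm
  have h1 : f.eval 1 = F 1 := (hFeval 1 ⟨zero_le_one, le_rfl⟩).symm
  have hae : ∀ᵐ x ∂vol01, deriv (fun x => Real.exp (β * x) * (F x * F x)) x =
      2 * (Real.exp (β * x) * (H1.toL2 f x * f.deriv x)) +
        β * (Real.exp (β * x) * (H1.toL2 f x * H1.toL2 f x)) := by
    filter_upwards [ae_mem_Icc, ae_restrict_of_ae (H1.ae_hasDerivAt f), H1.toL2_ae f]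
      with x hx hd ht
    have hd : HasDerivAt F (f.deriv x) x := hd hx
    have he : HasDerivAt (fun x => Real.exp (β * x)) (Real.exp (β * x) * β) x := by
      simpa using ((hasDerivAt_id x).const_mul β).exp
    rw [(he.fun_mul (hd.fun_mul hd)).deriv, ht, ← hFeval x hx]
    ring
  have hint : Integrable (fun x => Real.exp (β * x) * (H1.toL2 f x * f.deriv x)) vol01 := by
    refine (L2.integrable_inner (𝕜 := ℝ) (H1.toL2 f) (mulExp β f.deriv)).congr ?_
    filter_upwards [mulExp_ae β f.deriv] with x hx
    rw [hx]
    simp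
    ring
  rw [← integral_vol01, integral_congr_ae hae, integral_add (hint.const_mul 2)
    ((integrable_exp_sq β (H1.toL2 f)).const_mul β), integral_const_mul, integral_const_mul,
    integral_vol01, integral_vol01, ← wInner_eq_integral, ← wInner_eq_integral] at hftc
  rw [h0, h1]
  simp only [mul_zero, Real.exp_zero, mul_one] at hftc
  linarith

/-- The functions used as initial data: continuous on `ℝ` and zero outside `(0,1)`. -/
structure IsTest (f : ℝ → ℝ) : Prop where
  continuous : Continuous f
  zero_of_le : ∀ x ≤ 0, f x = 0
  zero_of_ge : ∀ x, 1 ≤ x → f x = 0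

/-- The `L²` class of a continuous function on `ℝ`. -/
def restrL2 : C(ℝ, ℝ) →ₗ[ℝ] L2 where
  toFun f := contToL2 (f.restrict (Icc 0 1))
  map_add' f f' := map_add contToL2 (f.restrict (Icc 0 1)) (f'.restrict (Icc 0 1))
  map_smul' r f := map_smul contToL2 r (f.restrict (Icc 0 1))

theorem restrL2_apply (f : C(ℝ, ℝ)) : restrL2 f = contToL2 (f.restrict (Icc 0 1)) := rfl

theorem restrL2_ae (f : C(ℝ, ℝ)) : restrL2 f =ᵐ[vol01] f := by
  filter_upwards [contToL2_ae (f.restrict (Icc 0 1)), ae_mem_Icc] with x h hx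
  rw [restrL2_apply, h, projIcc_of_mem zero_le_one hx]
  rfl

theorem restrL2_congr {f f' : C(ℝ, ℝ)} (h : ∀ x ∈ Icc (0 : ℝ) 1, f x = f' x) :
    restrL2 f = restrL2 f' := by
  refine Lp.ext ?_
  filter_upwards [restrL2_ae f, restrL2_ae f', ae_mem_Icc] with x h1 h2 hx
  rw [h1, h2, h x hx]

/-- The `L²` classes of the test functions. -/
def testL2 : Submodule ℝ L2 where
  carrier := {w | ∃ f : C(ℝ, ℝ), IsTest f ∧ restrL2 f = w}
  zero_mem' := ⟨0, ⟨continuous_const, fun _ _ => rfl, fun _ _ => rfl⟩, map_zero _⟩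
  add_mem' := by
    rintro _ _ ⟨f, hf, rfl⟩ ⟨f', hf', rfl⟩
    exact ⟨f + f', ⟨by fun_prop,
      fun x hx => by simp [hf.zero_of_le x hx, hf'.zero_of_le x hx],
      fun x hx => by simp [hf.zero_of_ge x hx, hf'.zero_of_ge x hx]⟩, map_add _ _ _⟩
  smul_mem' := by
    rintro r _ ⟨f, hf, rfl⟩
    exact ⟨r • f, ⟨by fun_prop, fun x hx => by simp [hf.zero_of_le x hx],
      fun x hx => by simp [hf.zero_of_ge x hx]⟩, map_smul _ _ _⟩

theorem dense_testL2 : Dense (testL2 : Set L2) := by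
  rw [Submodule.dense_iff_topologicalClosure_eq_top, ← Submodule.orthogonal_eq_bot_iff,
    Submodule.eq_bot_iff]
  intro w hw
  have hae : ∀ᵐ x ∂(volume : Measure ℝ), x ∈ Ioo (0 : ℝ) 1 → w x = 0 := by
    refine IsOpen.ae_eq_zero_of_integral_contDiff_smul_eq_zero isOpen_Ioo ?_ ?_
    · have : IntegrableOn w (Icc 0 1) volume := (Lp.memLp w).integrable one_le_two
      exact (this.mono_set (t := Icc 0 1) Ioo_subset_Icc_self).locallyIntegrableOn
    · -- The integral of `w` against a smooth function with support in `(0,1)` is an inner product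
      -- with an element of `testL2`.
      intro φ hφ _ hsupp
      have hz : ∀ x, x ∉ Ioo (0 : ℝ) 1 → φ x = 0 := fun x hx =>
        image_eq_zero_of_notMem_tsupport fun hx' => hx (hsupp hx')
      have hin := (Submodule.mem_orthogonal _ w).1 hw _ (Submodule.le_topologicalClosure _
        ⟨⟨φ, hφ.continuous⟩, ⟨hφ.continuous, fun x hx => hz x fun h' => absurd h'.1 hx.not_gt,
          fun x hx => hz x fun h' => absurd h'.2 hx.not_gt⟩, rfl⟩)
      rw [L2.inner_def] at hin
      have hres : ∫ x, φ x • w x ∂vol01 = ∫ x, φ x • w x :=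
        setIntegral_eq_integral_of_forall_compl_eq_zero fun x hx => by
          rw [hz x fun h' => hx (Ioo_subset_Icc_self h'), zero_smul]
      rw [← hres, ← hin]
      refine integral_congr_ae ?_
      filter_upwards [restrL2_ae ⟨φ, hφ.continuous⟩] with x hx
      rw [hx]
      simp [mul_comm]
  refine Lp.ext (EventuallyEq.trans ?_ (Lp.coeFn_zero ℝ 2 vol01).symm)
  have h0 : ∀ᵐ x : ℝ, x ≠ 0 := by simp [ae_iff, measure_singleton]
  have h1 : ∀ᵐ x : ℝ, x ≠ 1 := by simp [ae_iff, measure_singleton]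
  filter_upwards [ae_mem_Icc, ae_restrict_of_ae hae, ae_restrict_of_ae h0,
    ae_restrict_of_ae h1] with x hx hw h0 h1
  exact hw ⟨lt_of_le_of_ne hx.1 h0.symm, lt_of_le_of_ne hx.2 h1⟩

/-! ### The generator of the closed loop -/

namespace StateSpace

/-- The component `u` as a continuous linear map. -/
def uL : StateSpace →L[ℝ] H1 :=
  (ContinuousLinearMap.fst ℝ _ _).comp stateSubmodule.subtypeL

/-- The component `u_t` as a continuous linear map. -/
def utL : StateSpace →L[ℝ] L2 :=
  (ContinuousLinearMap.fst ℝ _ _).comp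
    ((ContinuousLinearMap.snd ℝ _ _).comp stateSubmodule.subtypeL)

/-- The component `v` as a continuous linear map. -/
def vL : StateSpace →L[ℝ] H1 :=
  (ContinuousLinearMap.fst ℝ _ _).comp ((ContinuousLinearMap.snd ℝ _ _).comp
    ((ContinuousLinearMap.snd ℝ _ _).comp stateSubmodule.subtypeL))

/-- The component `v_t` as a continuous linear map. -/
def vtL : StateSpace →L[ℝ] L2 :=
  (ContinuousLinearMap.snd ℝ _ _).comp ((ContinuousLinearMap.snd ℝ _ _).comp
    ((ContinuousLinearMap.snd ℝ _ _).comp stateSubmodule.subtypeL))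

theorem eval_one_eq (z : StateSpace) : z.u.eval 1 = z.v.eval 0 := z.2

theorem ext_components {z y : StateSpace} (hu : z.u = y.u) (hut : z.ut = y.ut) (hv : z.v = y.v)
    (hvt : z.vt = y.vt) : z = y :=
  Subtype.ext (Prod.ext hu (Prod.ext hut (Prod.ext hv hvt)))

/-- The norm of `𝓗`, the maximum of the norms of the components. -/
theorem norm_eq (z : StateSpace) : ‖z‖ = max ‖z.u‖ (max ‖z.ut‖ (max ‖z.v‖ ‖z.vt‖)) := rfl

/-- The state with `u(0) = k` and prescribed `u_x`, `u_t`, `v_x`, `v_t`. -/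
def mk : ℝ × L2 × L2 × L2 × L2 →L[ℝ] StateSpace :=
  let k := ContinuousLinearMap.fst ℝ ℝ (L2 × L2 × L2 × L2)
  let w := ContinuousLinearMap.snd ℝ ℝ (L2 × L2 × L2 × L2)
  let ux := (ContinuousLinearMap.fst ℝ L2 (L2 × L2 × L2)).comp w
  let w' := (ContinuousLinearMap.snd ℝ L2 (L2 × L2 × L2)).comp w
  let ut := (ContinuousLinearMap.fst ℝ L2 (L2 × L2)).comp w'
  let w'' := (ContinuousLinearMap.snd ℝ L2 (L2 × L2)).comp w'
  let vx := (ContinuousLinearMap.fst ℝ L2 L2).comp w''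
  let vt := (ContinuousLinearMap.snd ℝ L2 L2).comp w''
  let u := H1.ofDeriv.comp (k.prod ux)
  let v := H1.ofDeriv.comp (((H1.evalL 1).comp u).prod vx)
  (u.prod (ut.prod (v.prod vt))).codRestrict stateSubmodule fun x =>
    (H1.ofDeriv_eval_zero (H1.evalL 1 (u x), vx x)).symm

theorem mk_u (x : ℝ × L2 × L2 × L2 × L2) : (mk x).u = H1.ofDeriv (x.1, x.2.1) := rfl
theorem mk_v (x : ℝ × L2 × L2 × L2 × L2) :
    (mk x).v = H1.ofDeriv ((H1.ofDeriv (x.1, x.2.1)).eval 1, x.2.2.2.1) := rfl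

theorem mk_components (z : StateSpace) :
    mk (z.u.eval 0, z.u.deriv, z.ut, z.v.deriv, z.vt) = z := by
  refine ext_components ?_ rfl ?_ rfl
  · rw [mk_u, H1.ofDeriv_eval_deriv]
  · rw [mk_v, H1.ofDeriv_eval_deriv, eval_one_eq, H1.ofDeriv_eval_deriv]

end StateSpace

open StateSpace

/-- The domain of `T` and its action, for `q = 0`, with equality in `L²` in place of equality
almost everywhere. -/
theorem isGenerator_iff {c₁ c₂ g h : ℝ} {Z Y : StateSpace} :
    IsGenerator c₁ c₂ g h 0 Z Y ↔ Z.ut = H1.toL2 Y.u ∧ Z.vt = H1.toL2 Y.v ∧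
      ∃ ux vx : H1, Z.u.deriv = H1.toL2 ux ∧ Z.v.deriv = H1.toL2 vx ∧
        Y.ut = c₁ ^ 2 • ux.deriv ∧ Y.vt = c₂ ^ 2 • vx.deriv ∧
        ux.eval 0 = g * Y.u.eval 0 ∧ vx.eval 0 = ux.eval 1 ∧ vx.eval 1 = -h * Y.v.eval 1 := by
  simp only [IsGenerator, H1.ae_eq_eval_iff, zero_mul, sub_zero]

/-- The graph of the operator `T` of the closed loop with `q = 0`. -/
def generator (c₁ c₂ g h : ℝ) : Submodule ℝ (StateSpace × StateSpace) where
  carrier := {x | IsGenerator c₁ c₂ g h 0 x.1 x.2}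
  zero_mem' := by
    refine isGenerator_iff.2 ⟨?_, ?_, 0, 0, ?_, ?_, ?_, ?_, ?_, ?_, ?_⟩
    · exact (map_zero H1.toL2).symm
    · exact (map_zero H1.toL2).symm
    · exact (map_zero H1.toL2).symm
    · exact (map_zero H1.toL2).symm
    · exact (smul_zero _).symm
    · exact (smul_zero _).symm
    · exact (mul_zero g).symm
    · rfl
    · exact (mul_zero (-h)).symm
  add_mem' := by
    rintro ⟨Z, Y⟩ ⟨Z', Y'⟩ hx hx'
    obtain ⟨h1, h2, ux, vx, h3, h4, h5, h6, h7, h8, h9⟩ := isGenerator_iff.1 hx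
    obtain ⟨k1, k2, ux', vx', k3, k4, k5, k6, k7, k8, k9⟩ := isGenerator_iff.1 hx'
    refine isGenerator_iff.2 ⟨?_, ?_, ux + ux', vx + vx', ?_, ?_, ?_, ?_, ?_, ?_, ?_⟩
    · exact (congrArg₂ (· + ·) h1 k1).trans (map_add H1.toL2 _ _).symm
    · exact (congrArg₂ (· + ·) h2 k2).trans (map_add H1.toL2 _ _).symm
    · exact (congrArg₂ (· + ·) h3 k3).trans (map_add H1.toL2 _ _).symm
    · exact (congrArg₂ (· + ·) h4 k4).trans (map_add H1.toL2 _ _).symm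
    · exact (congrArg₂ (· + ·) h5 k5).trans (smul_add _ _ _).symm
    · exact (congrArg₂ (· + ·) h6 k6).trans (smul_add _ _ _).symm
    · exact (congrArg₂ (· + ·) h7 k7).trans (mul_add _ _ _).symm
    · exact congrArg₂ (· + ·) h8 k8
    · exact (congrArg₂ (· + ·) h9 k9).trans (mul_add _ _ _).symm
  smul_mem' := by
    rintro r ⟨Z, Y⟩ hx
    obtain ⟨h1, h2, ux, vx, h3, h4, h5, h6, h7, h8, h9⟩ := isGenerator_iff.1 hx
    refine isGenerator_iff.2 ⟨?_, ?_, r • ux, r • vx, ?_, ?_, ?_, ?_, ?_, ?_, ?_⟩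
    · exact (congrArg (r • ·) h1).trans (map_smul H1.toL2 _ _).symm
    · exact (congrArg (r • ·) h2).trans (map_smul H1.toL2 _ _).symm
    · exact (congrArg (r • ·) h3).trans (map_smul H1.toL2 _ _).symm
    · exact (congrArg (r • ·) h4).trans (map_smul H1.toL2 _ _).symm
    · exact (congrArg (r • ·) h5).trans (smul_comm _ _ _)
    · exact (congrArg (r • ·) h6).trans (smul_comm _ _ _)
    · exact (congrArg (r * ·) h7).trans (mul_left_comm _ _ _)
    · exact congrArg (r * ·) h8
    · exact (congrArg (r * ·) h9).trans (mul_left_comm _ _ _)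

/-- `H¹` is complete for the graph norm of the weak derivative. -/
theorem H1.isClosedEmbedding_toL2_prod_deriv :
    IsClosedEmbedding fun f : H1 => (H1.toL2 f, f.deriv) := by
  have hanti : AntilipschitzWith 3 fun f : H1 => (H1.toL2 f, f.deriv) := by
    refine AddMonoidHomClass.antilipschitz_of_bound (H1.toL2.prod H1.derivL) fun f => ?_
    have h := H1.norm_le f
    have h1 : ‖H1.toL2 f‖ ≤ ‖(H1.toL2 f, H1.derivL f)‖ := le_max_left _ _
    have h2 : ‖f.deriv‖ ≤ ‖(H1.toL2 f, H1.derivL f)‖ := le_max_right _ _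
    refine h.trans ?_
    change _ ≤ 3 * ‖(H1.toL2 f, H1.derivL f)‖
    linarith
  exact hanti.isClosedEmbedding (H1.toL2.prod H1.derivL).uniformContinuous

/-- The operator `T` is closed. -/
theorem isClosed_generator {c₁ : ℝ} (hc₁ : 0 < c₁) {c₂ : ℝ} (hc₂ : 0 < c₂) (g h : ℝ) :
    IsClosed (generator c₁ c₂ g h : Set (StateSpace × StateSpace)) := by
  refine IsSeqClosed.isClosed fun x y hx hxy => ?_
  have hZ := (continuous_fst.tendsto y).comp hxy
  have hY := (continuous_snd.tendsto y).comp hxy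
  choose h1 h2 ux vx h3 h4 h5 h6 h7 h8 h9 using fun n => isGenerator_iff.1 (hx n)
  have lim : ∀ {E : Type} [TopologicalSpace E] (f : StateSpace → E), Continuous f →
      Tendsto (fun n => f (x n).1) atTop (𝓝 (f y.1)) ∧
      Tendsto (fun n => f (x n).2) atTop (𝓝 (f y.2)) := fun f hf =>
    ⟨(hf.tendsto _).comp hZ, (hf.tendsto _).comp hY⟩
  have key : ∀ {c : ℝ}, 0 < c → ∀ {w : ℕ → H1} {a b : L2},
      Tendsto (fun n => H1.toL2 (w n)) atTop (𝓝 a) →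
      Tendsto (fun n => c ^ 2 • (w n).deriv) atTop (𝓝 b) →
      ∃ f : H1, Tendsto w atTop (𝓝 f) ∧ a = H1.toL2 f ∧ b = c ^ 2 • f.deriv := by
    intro c hc w a b ha hb
    have hb' : Tendsto (fun n => (w n).deriv) atTop (𝓝 ((c ^ 2)⁻¹ • b)) := by
      refine (hb.const_smul ((c ^ 2)⁻¹)).congr fun n => ?_
      rw [inv_smul_smul₀ (by positivity)]
    have hlim := ha.prodMk_nhds hb'
    obtain ⟨f, hf⟩ := H1.isClosedEmbedding_toL2_prod_deriv.isClosed_range.mem_of_tendsto hlim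
      (Eventually.of_forall fun n => ⟨w n, rfl⟩)
    replace hf : (H1.toL2 f, f.deriv) = (a, (c ^ 2)⁻¹ • b) := hf
    refine ⟨f, ?_, (congrArg Prod.fst hf).symm, ?_⟩
    · rw [H1.isClosedEmbedding_toL2_prod_deriv.isInducing.tendsto_nhds_iff]
      exact hf ▸ hlim
    · rw [show f.deriv = (c ^ 2)⁻¹ • b from congrArg Prod.snd hf, smul_inv_smul₀ (by positivity)]
  obtain ⟨ux', hux, hux1, hux2⟩ := key hc₁
    ((lim _ (H1.derivL.comp uL).continuous).1.congr h3) ((lim _ utL.continuous).2.congr h5)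
  obtain ⟨vx', hvx, hvx1, hvx2⟩ := key hc₂
    ((lim _ (H1.derivL.comp vL).continuous).1.congr h4) ((lim _ vtL.continuous).2.congr h6)
  have ev : ∀ (s : ℝ) {w : ℕ → H1} {f : H1}, Tendsto w atTop (𝓝 f) →
      Tendsto (fun n => (w n).eval s) atTop (𝓝 (f.eval s)) := fun s w f hf =>
    ((H1.evalL s).continuous.tendsto f).comp hf
  refine isGenerator_iff.2 ⟨?_, ?_, ux', vx', hux1, hvx1, hux2, hvx2, ?_, ?_, ?_⟩
  · exact tendsto_nhds_unique ((lim _ utL.continuous).1.congr h1)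
      (lim _ (H1.toL2.comp uL).continuous).2
  · exact tendsto_nhds_unique ((lim _ vtL.continuous).1.congr h2)
      (lim _ (H1.toL2.comp vL).continuous).2
  · exact tendsto_nhds_unique ((ev 0 hux).congr h7)
      ((ev 0 (lim _ uL.continuous).2).const_mul g)
  · exact tendsto_nhds_unique ((ev 0 hvx).congr h8) (ev 1 hux)
  · exact tendsto_nhds_unique ((ev 1 hvx).congr h9)
      ((ev 1 (lim _ vL.continuous).2).const_mul (-h))

/-- `T` is single-valued. -/
theorem eq_zero_of_isGenerator_zero {c₁ c₂ g h : ℝ} {Y : StateSpace}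
    (hY : IsGenerator c₁ c₂ g h 0 0 Y) : Y = 0 := by
  obtain ⟨h1, h2, ux, vx, h3, h4, h5, h6, -⟩ := isGenerator_iff.1 hY
  have hux : ux = 0 := H1.eq_zero_of_toL2_eq_zero h3.symm
  have hvx : vx = 0 := H1.eq_zero_of_toL2_eq_zero h4.symm
  refine ext_components (H1.eq_zero_of_toL2_eq_zero h1.symm) ?_
    (H1.eq_zero_of_toL2_eq_zero h2.symm) ?_
  · rw [h5, hux]
    exact smul_zero _
  · rw [h6, hvx]
    exact smul_zero _

/-! ### The weighted energy -/

/-- Weights `Sᵢ` and a rate `α` for which the boundary form of the closed loop with `q = 0` is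
nonpositive. Here `p₀`, `p₁`, `r₁` stand for the velocities at the left end, at the junction and at
the right end, and `w` for the slope at the junction. The left-hand side is the weighted energy of
the incoming, the right-hand side that of the outgoing Riemann coordinates. -/
structure DecayWeights (c₁ c₂ g h : ℝ) where
  c₁_pos : 0 < c₁
  c₂_pos : 0 < c₂
  S₁ : ℝ
  S₂ : ℝ
  S₃ : ℝ
  S₄ : ℝ
  α : ℝ
  S₁_pos : 0 < S₁
  S₂_pos : 0 < S₂
  S₃_pos : 0 < S₃
  S₄_pos : 0 < S₄
  α_pos : 0 < α
  boundary : ∀ p₀ w p₁ r₁ : ℝ,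
    S₁ * (Real.exp (2 * α / c₁) * (p₁ + c₁ * w) ^ 2) +
      S₂ * (Real.exp (2 * α / c₁) * ((1 - c₁ * g) * p₀) ^ 2) +
      S₃ * (Real.exp (2 * α / c₂) * ((1 - c₂ * h) * r₁) ^ 2) +
      S₄ * (Real.exp (2 * α / c₂) * (p₁ - c₂ * w) ^ 2) ≤
    S₁ * ((1 + c₁ * g) * p₀) ^ 2 + S₂ * (p₁ - c₁ * w) ^ 2 +
      S₃ * (p₁ + c₂ * w) ^ 2 + S₄ * ((1 + c₂ * h) * r₁) ^ 2

/-- The Riemann coordinate `u_t + c u_x` of the first wave equation; it travels with velocity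
`-c`. -/
def riemannU (c : ℝ) : StateSpace →L[ℝ] L2 := utL + c • H1.derivL.comp uL

/-- The Riemann coordinate `v_t + c v_x` of the second wave equation; it travels with velocity
`-c`. -/
def riemannV (c : ℝ) : StateSpace →L[ℝ] L2 := vtL + c • H1.derivL.comp vL

theorem riemannU_apply (c : ℝ) (z : StateSpace) : riemannU c z = z.ut + c • z.u.deriv := rfl

theorem riemannV_apply (c : ℝ) (z : StateSpace) : riemannV c z = z.vt + c • z.v.deriv := rfl

namespace StateSpace

theorem seminorm_sq (c₁ c₂ : ℝ) (z : StateSpace) : z.seminorm c₁ c₂ ^ 2 =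
    c₁ ^ 2 * ‖z.u.deriv‖ ^ 2 + ‖z.ut‖ ^ 2 + c₂ ^ 2 * ‖z.v.deriv‖ ^ 2 + ‖z.vt‖ ^ 2 :=
  Real.sq_sqrt (by positivity)

/-- In Riemann coordinates the energy is, up to the factor `2`, the sum of the squares. -/
theorem two_mul_seminorm_sq (c₁ c₂ : ℝ) (z : StateSpace) : 2 * z.seminorm c₁ c₂ ^ 2 =
    ‖riemannU c₁ z‖ ^ 2 + ‖riemannU (-c₁) z‖ ^ 2 +
      ‖riemannV c₂ z‖ ^ 2 + ‖riemannV (-c₂) z‖ ^ 2 := by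
  have e (f f' : L2) (c : ℝ) :
      ‖f + c • f'‖ ^ 2 + ‖f + (-c) • f'‖ ^ 2 = 2 * (‖f‖ ^ 2 + c ^ 2 * ‖f'‖ ^ 2) := by
    have := parallelogram_law_with_norm ℝ f (c • f')
    rw [neg_smul, ← sub_eq_add_neg, this, norm_smul, mul_pow, Real.norm_eq_abs, sq_abs]
  have h1 := e z.ut z.u.deriv c₁
  have h2 := e z.vt z.v.deriv c₂
  simp only [riemannU_apply, riemannV_apply, seminorm_sq]
  linarith

end StateSpace

namespace DecayWeights

variable {c₁ c₂ g h : ℝ} (W : DecayWeights c₁ c₂ g h)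

/-- The weighted energy, as a bilinear form: each Riemann coordinate is weighted with an exponential
that equals `1` where the coordinate leaves its interval and increases towards the end where it
enters. -/
def energy (z y : StateSpace) : ℝ :=
  W.S₁ / c₁ * wInner (2 * W.α / c₁) (riemannU c₁ z) (riemannU c₁ y) +
  W.S₂ / c₁ * (Real.exp (2 * W.α / c₁) *
    wInner (-(2 * W.α / c₁)) (riemannU (-c₁) z) (riemannU (-c₁) y)) +
  W.S₃ / c₂ * wInner (2 * W.α / c₂) (riemannV c₂ z) (riemannV c₂ y) +
  W.S₄ / c₂ * (Real.exp (2 * W.α / c₂) *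
    wInner (-(2 * W.α / c₂)) (riemannV (-c₂) z) (riemannV (-c₂) y))

end DecayWeights

theorem wInner_smul_smul (β r : ℝ) (f f' : L2) :
    wInner β (r • f) (r • f') = r ^ 2 * wInner β f f' := by
  simp only [wInner, map_smul, inner_smul_left, inner_smul_right]
  simp
  ring

theorem hasDerivAt_wInner {β t : ℝ} {f : ℝ → L2} {f' : L2} (hf : HasDerivAt f f' t) :
    HasDerivAt (fun s => wInner β (f s) (f s)) (2 * wInner β (f t) f') t := by
  have h := hf.inner ℝ ((mulExp β).hasFDerivAt.comp_hasDerivAt t hf)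
  have e : inner ℝ (f t) (mulExp β f') + inner ℝ f' (mulExp β (f t)) =
      2 * wInner β (f t) f' := by
    change wInner β (f t) f' + wInner β f' (f t) = _
    rw [wInner_comm β f']
    ring
  exact e ▸ h

theorem hasDerivAt_clm_apply {E F : Type*} [NormedAddCommGroup E] [NormedSpace ℝ E]
    [NormedAddCommGroup F] [NormedSpace ℝ F] (L : E →L[ℝ] F) {f : ℝ → E} {f' : E} {t : ℝ}
    (hf : HasDerivAt f f' t) : HasDerivAt (fun s => L (f s)) (L f') t :=
  L.hasFDerivAt.comp_hasDerivAt t hf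

theorem continuous_wInner (β : ℝ) : Continuous fun f : L2 => wInner β f f :=
  continuous_id.inner (mulExp β).continuous

namespace DecayWeights

variable {c₁ c₂ g h : ℝ} (W : DecayWeights c₁ c₂ g h)

theorem energy_smul_smul (r : ℝ) (z : StateSpace) :
    W.energy (r • z) (r • z) = r ^ 2 * W.energy z z := by
  simp only [energy, map_smul, wInner_smul_smul]
  ring

theorem continuous_energy : Continuous fun z => W.energy z z := by
  have h (β : ℝ) (L : StateSpace →L[ℝ] L2) : Continuous fun z => wInner β (L z) (L z) :=
    (continuous_wInner β).comp L.continuous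
  unfold energy
  exact ((((h _ _).const_mul _).add (((h _ _).const_mul _).const_mul _)).add
    ((h _ _).const_mul _)).add (((h _ _).const_mul _).const_mul _)

theorem hasDerivAt_energy {D : ℝ → StateSpace} {D' : StateSpace} {t : ℝ} (hD : HasDerivAt D D' t) :
    HasDerivAt (fun s => W.energy (D s) (D s)) (2 * W.energy (D t) D') t := by
  have h (β : ℝ) (L : StateSpace →L[ℝ] L2) :
      HasDerivAt (fun s => wInner β (L (D s)) (L (D s))) (2 * wInner β (L (D t)) (L D')) t :=
    hasDerivAt_wInner (hasDerivAt_clm_apply (E := StateSpace) (F := L2) L hD)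
  unfold energy
  refine (((((h _ _).const_mul _).add (((h _ _).const_mul _).const_mul _)).add
    ((h _ _).const_mul _)).add (((h _ _).const_mul _).const_mul _)).congr_deriv ?_
  ring

/-- The dissipation inequality: integration by parts turns the energy production into boundary
terms, which `DecayWeights.boundary` estimates, and a term that comes from the weights. -/
theorem energy_generator_le {Z Y : StateSpace} (hZ : IsGenerator c₁ c₂ g h 0 Z Y) :
    W.energy Z Y ≤ -W.α * W.energy Z Z := by
  obtain ⟨h1, h2, ux, vx, h3, h4, h5, h6, h7, h8, h9⟩ := isGenerator_iff.1 hZ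
  have hc₁ := W.c₁_pos.ne'
  have hc₂ := W.c₂_pos.ne'
  have eU (c : ℝ) (hc : c ^ 2 = c₁ ^ 2) : riemannU c Z = H1.toL2 (Y.u + c • ux) ∧
      riemannU c Y = c • (Y.u + c • ux).deriv := by
    constructor
    · rw [riemannU_apply, map_add, map_smul, h1, h3]
    · change Y.ut + c • Y.u.deriv = c • (Y.u.deriv + c • ux.deriv)
      rw [h5, ← hc, smul_add, smul_smul, sq, add_comm]
  have eV (c : ℝ) (hc : c ^ 2 = c₂ ^ 2) : riemannV c Z = H1.toL2 (Y.v + c • vx) ∧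
      riemannV c Y = c • (Y.v + c • vx).deriv := by
    constructor
    · rw [riemannV_apply, map_add, map_smul, h2, h4]
    · change Y.vt + c • Y.v.deriv = c • (Y.v.deriv + c • vx.deriv)
      rw [h6, ← hc, smul_add, smul_smul, sq, add_comm]
  have ev (f f' : H1) (c x : ℝ) : (f + c • f').eval x = f.eval x + c * f'.eval x := rfl
  have ws (β c : ℝ) (f f' : L2) : wInner β f (c • f') = c * wInner β f f' := by
    simp only [wInner, map_smul, inner_smul_right]
  obtain ⟨a1, a2⟩ := eU c₁ rfl
  obtain ⟨b1, b2⟩ := eU (-c₁) (neg_sq c₁)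
  obtain ⟨d1, d2⟩ := eV c₂ rfl
  obtain ⟨e1, e2⟩ := eV (-c₂) (neg_sq c₂)
  have ia := two_mul_wInner_deriv (2 * W.α / c₁) (Y.u + c₁ • ux)
  have ib := two_mul_wInner_deriv (-(2 * W.α / c₁)) (Y.u + (-c₁) • ux)
  have ic := two_mul_wInner_deriv (2 * W.α / c₂) (Y.v + c₂ • vx)
  have id := two_mul_wInner_deriv (-(2 * W.α / c₂)) (Y.v + (-c₂) • vx)
  simp only [ev, ← a1, ← b1, ← d1, ← e1] at ia ib ic id
  unfold energy
  rw [a2, b2, d2, e2]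
  simp only [ws]
  have hb := W.boundary (Y.u.eval 0) (ux.eval 1) (Y.u.eval 1) (Y.v.eval 1)
  have hj : Y.v.eval 0 = Y.u.eval 1 := Y.eval_one_eq.symm
  rw [h7] at ia ib
  rw [h8, h9, hj] at ic id
  have x1 : Real.exp (2 * W.α / c₁) * Real.exp (-(2 * W.α / c₁)) = 1 := by
    rw [← Real.exp_add, add_neg_cancel, Real.exp_zero]
  have x2 : Real.exp (2 * W.α / c₂) * Real.exp (-(2 * W.α / c₂)) = 1 := by
    rw [← Real.exp_add, add_neg_cancel, Real.exp_zero]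
  set E₁ := Real.exp (2 * W.α / c₁)
  set E₂ := Real.exp (2 * W.α / c₂)
  set F₁ := Real.exp (-(2 * W.α / c₁))
  set F₂ := Real.exp (-(2 * W.α / c₂))
  set A := wInner (2 * W.α / c₁) (riemannU c₁ Z) (Y.u + c₁ • ux).deriv
  set B := wInner (-(2 * W.α / c₁)) (riemannU (-c₁) Z) (Y.u + -c₁ • ux).deriv
  set C := wInner (2 * W.α / c₂) (riemannV c₂ Z) (Y.v + c₂ • vx).deriv
  set D := wInner (-(2 * W.α / c₂)) (riemannV (-c₂) Z) (Y.v + -c₂ • vx).deriv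
  set A' := wInner (2 * W.α / c₁) (riemannU c₁ Z) (riemannU c₁ Z)
  set B' := wInner (-(2 * W.α / c₁)) (riemannU (-c₁) Z) (riemannU (-c₁) Z)
  set C' := wInner (2 * W.α / c₂) (riemannV c₂ Z) (riemannV c₂ Z)
  set D' := wInner (-(2 * W.α / c₂)) (riemannV (-c₂) Z) (riemannV (-c₂) Z)
  have k1 : W.S₁ / c₁ * (c₁ * A) = W.S₁ * A := by field_simp
  have k2 : W.S₂ / c₁ * (E₁ * (-c₁ * B)) = -(W.S₂ * E₁ * B) := by field_simp
  have k3 : W.S₃ / c₂ * (c₂ * C) = W.S₃ * C := by field_simp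
  have k4 : W.S₄ / c₂ * (E₂ * (-c₂ * D)) = -(W.S₄ * E₂ * D) := by field_simp
  rw [k1, k2, k3, k4]
  have A2 : W.S₁ * A = W.S₁ * (E₁ * (Y.u.eval 1 + c₁ * ux.eval 1) ^ 2 -
      ((1 + c₁ * g) * Y.u.eval 0) ^ 2) / 2 - W.α * (W.S₁ / c₁ * A') := by
    rw [show A = (2 * A) / 2 by ring, ia]
    ring
  have B2 : -(W.S₂ * E₁ * B) = W.S₂ * (E₁ * ((1 - c₁ * g) * Y.u.eval 0) ^ 2 -
      (Y.u.eval 1 - c₁ * ux.eval 1) ^ 2) / 2 - W.α * (W.S₂ / c₁ * (E₁ * B')) := by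
    rw [show B = (2 * B) / 2 by ring, ib]
    linear_combination (-W.S₂ * (Y.u.eval 1 - c₁ * ux.eval 1) ^ 2 / 2) * x1
  have C2 : W.S₃ * C = W.S₃ * (E₂ * ((1 - c₂ * h) * Y.v.eval 1) ^ 2 -
      (Y.u.eval 1 + c₂ * ux.eval 1) ^ 2) / 2 - W.α * (W.S₃ / c₂ * C') := by
    rw [show C = (2 * C) / 2 by ring, ic]
    ring
  have D2 : -(W.S₄ * E₂ * D) = W.S₄ * (E₂ * (Y.u.eval 1 - c₂ * ux.eval 1) ^ 2 -
      ((1 + c₂ * h) * Y.v.eval 1) ^ 2) / 2 - W.α * (W.S₄ / c₂ * (E₂ * D')) := by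
    rw [show D = (2 * D) / 2 by ring, id]
    linear_combination (-W.S₄ * ((1 + c₂ * h) * Y.v.eval 1) ^ 2 / 2) * x2
  rw [A2, B2, C2, D2]
  linarith

/-- The weighted energy is equivalent to the square of the seminorm of `𝓗`. -/
theorem exists_energy_bounds : ∃ m M : ℝ, 0 < m ∧ 0 < M ∧ ∀ z : StateSpace,
    m * z.seminorm c₁ c₂ ^ 2 ≤ W.energy z z ∧ W.energy z z ≤ M * z.seminorm c₁ c₂ ^ 2 := by
  have hc₁ := W.c₁_pos
  have hc₂ := W.c₂_pos
  have p1 := W.S₁_pos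
  have p2 := W.S₂_pos
  have p3 := W.S₃_pos
  have p4 := W.S₄_pos
  have key (k β : ℝ) (hk : 0 < k) (f : L2) :
      k * Real.exp (-|β|) * ‖f‖ ^ 2 ≤ k * wInner β f f ∧
        k * wInner β f f ≤ k * Real.exp |β| * ‖f‖ ^ 2 := by
    rw [mul_assoc, mul_assoc]
    exact ⟨mul_le_mul_of_nonneg_left (le_wInner_self β f) hk.le,
      mul_le_mul_of_nonneg_left (wInner_self_le β f) hk.le⟩
  set k₁ := W.S₁ / c₁ with h1
  set k₂ := W.S₂ / c₁ * Real.exp (2 * W.α / c₁) with h2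
  set k₃ := W.S₃ / c₂ with h3
  set k₄ := W.S₄ / c₂ * Real.exp (2 * W.α / c₂) with h4
  have q1 : 0 < k₁ := by positivity
  have q2 : 0 < k₂ := by positivity
  have q3 : 0 < k₃ := by positivity
  have q4 : 0 < k₄ := by positivity
  set e₁ := Real.exp (-|2 * W.α / c₁|)
  set e₂ := Real.exp (-|2 * W.α / c₂|)
  set f₁ := Real.exp |2 * W.α / c₁|
  set f₂ := Real.exp |2 * W.α / c₂|
  have pe1 : 0 < e₁ := Real.exp_pos _
  have pe2 : 0 < e₂ := Real.exp_pos _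
  have pf1 : 0 < f₁ := Real.exp_pos _
  have pf2 : 0 < f₂ := Real.exp_pos _
  refine ⟨2 * min (min (k₁ * e₁) (k₂ * e₁)) (min (k₃ * e₂) (k₄ * e₂)),
    2 * (k₁ * f₁ + k₂ * f₁ + (k₃ * f₂ + k₄ * f₂)), by positivity, by positivity, fun z => ?_⟩
  have a := key k₁ (2 * W.α / c₁) q1 (riemannU c₁ z)
  have b := key k₂ (-(2 * W.α / c₁)) q2 (riemannU (-c₁) z)
  have c := key k₃ (2 * W.α / c₂) q3 (riemannV c₂ z)
  have d := key k₄ (-(2 * W.α / c₂)) q4 (riemannV (-c₂) z)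
  simp only [abs_neg] at b d
  have hE : W.energy z z = k₁ * wInner (2 * W.α / c₁) (riemannU c₁ z) (riemannU c₁ z) +
      k₂ * wInner (-(2 * W.α / c₁)) (riemannU (-c₁) z) (riemannU (-c₁) z) +
      k₃ * wInner (2 * W.α / c₂) (riemannV c₂ z) (riemannV c₂ z) +
      k₄ * wInner (-(2 * W.α / c₂)) (riemannV (-c₂) z) (riemannV (-c₂) z) := by
    rw [energy, h2, h4]
    ring
  have hs := two_mul_seminorm_sq c₁ c₂ z
  have hk (k : ℝ) := (by rw [mul_comm 2 k, mul_assoc, hs] : 2 * k * z.seminorm c₁ c₂ ^ 2 = k * _)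
  rw [hE, hk, hk]
  set A := ‖riemannU c₁ z‖ ^ 2 with hA
  set B := ‖riemannU (-c₁) z‖ ^ 2 with hB
  set C := ‖riemannV c₂ z‖ ^ 2 with hC
  set D := ‖riemannV (-c₂) z‖ ^ 2 with hD
  have nA : 0 ≤ A := sq_nonneg _
  have nB : 0 ≤ B := sq_nonneg _
  have nC : 0 ≤ C := sq_nonneg _
  have nD : 0 ≤ D := sq_nonneg _
  constructor
  · set μ := min (min (k₁ * e₁) (k₂ * e₁)) (min (k₃ * e₂) (k₄ * e₂))
    have m1 : μ ≤ k₁ * e₁ := (min_le_left _ _).trans (min_le_left _ _)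
    have m2 : μ ≤ k₂ * e₁ := (min_le_left _ _).trans (min_le_right _ _)
    have m3 : μ ≤ k₃ * e₂ := (min_le_right _ _).trans (min_le_left _ _)
    have m4 : μ ≤ k₄ * e₂ := (min_le_right _ _).trans (min_le_right _ _)
    have := mul_le_mul_of_nonneg_right m1 nA
    have := mul_le_mul_of_nonneg_right m2 nB
    have := mul_le_mul_of_nonneg_right m3 nC
    have := mul_le_mul_of_nonneg_right m4 nD
    linarith [a.1, b.1, c.1, d.1]
  · set μ := k₁ * f₁ + k₂ * f₁ + (k₃ * f₂ + k₄ * f₂) with hμ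
    have r1 : 0 < k₁ * f₁ := by positivity
    have r2 : 0 < k₂ * f₁ := by positivity
    have r3 : 0 < k₃ * f₂ := by positivity
    have r4 : 0 < k₄ * f₂ := by positivity
    have := mul_le_mul_of_nonneg_right (show k₁ * f₁ ≤ μ by linarith) nA
    have := mul_le_mul_of_nonneg_right (show k₂ * f₁ ≤ μ by linarith) nB
    have := mul_le_mul_of_nonneg_right (show k₃ * f₂ ≤ μ by linarith) nC
    have := mul_le_mul_of_nonneg_right (show k₄ * f₂ ≤ μ by linarith) nD
    linarith [a.2, b.2, c.2, d.2]

end DecayWeights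

/-! ### Decay and continuous dependence -/

section

variable {c₁ c₂ g h T : ℝ} {z₀ : StateSpace} {z : ℝ → StateSpace}

theorem isMildSolution_iff :
    IsMildSolution (E := StateSpace) (generator c₁ c₂ g h) T z₀ z ↔ Continuous z ∧
      ∀ t ∈ Icc (0 : ℝ) T, IsGenerator c₁ c₂ g h 0 (∫ s in (0 : ℝ)..t, z s) (z t - z₀) := Iff.rfl

namespace DecayWeights

/-- The weighted energy decays along solutions. -/
def dissipativeForm (W : DecayWeights c₁ c₂ g h) :
    DissipativeForm (E := StateSpace) (generator c₁ c₂ g h) W.α where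
  B := W.energy
  smul_smul := W.energy_smul_smul
  continuous := W.continuous_energy
  hasDerivAt := W.hasDerivAt_energy
  dissipative := W.energy_generator_le

/-- Exponential decay in the seminorm of `𝓗`. -/
theorem exists_seminorm_le (W : DecayWeights c₁ c₂ g h) :
    ∃ γ : ℝ, 1 < γ ∧ ∀ (T : ℝ) (z₀ : StateSpace) (z : ℝ → StateSpace),
      IsMildSolution (E := StateSpace) (generator c₁ c₂ g h) T z₀ z → ∀ t ∈ Icc 0 T,
        (z t).seminorm c₁ c₂ ≤ γ * z₀.seminorm c₁ c₂ * Real.exp (-W.α * t) := by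
  obtain ⟨m, M, hm, hM, hmM⟩ := W.exists_energy_bounds
  have hs0 : 0 < Real.sqrt (M / m) := Real.sqrt_pos.2 (by positivity)
  refine ⟨Real.sqrt (M / m) + 1, by linarith, fun T z₀ z hz t ht => ?_⟩
  have n1 : 0 ≤ z₀.seminorm c₁ c₂ := Real.sqrt_nonneg _
  have he := Real.exp_pos (-W.α * t)
  have hdec : W.energy (z t) (z t) ≤ Real.exp (-2 * W.α * t) * W.energy z₀ z₀ :=
    hz.form_le (fun _ => eq_zero_of_isGenerator_zero) W.dissipativeForm ht
  have hsq : (z t).seminorm c₁ c₂ ^ 2 ≤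
      (Real.sqrt (M / m) * z₀.seminorm c₁ c₂ * Real.exp (-W.α * t)) ^ 2 := by
    have h1 : m * (z t).seminorm c₁ c₂ ^ 2 ≤
        Real.exp (-2 * W.α * t) * (M * z₀.seminorm c₁ c₂ ^ 2) :=
      ((hmM _).1.trans hdec).trans
        (mul_le_mul_of_nonneg_left (hmM z₀).2 (Real.exp_pos _).le)
    have h2 : Real.exp (-2 * W.α * t) = Real.exp (-W.α * t) ^ 2 := by
      rw [← Real.exp_nat_mul]
      congr 1
      push_cast
      ring
    rw [mul_pow, mul_pow, Real.sq_sqrt (by positivity), ← h2, div_mul_eq_mul_div,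
      div_mul_eq_mul_div, le_div_iff₀ hm]
    linarith
  refine (le_of_sq_le_sq hsq (by positivity)).trans ?_
  gcongr
  linarith

/-- Mild solutions on a bounded interval depend continuously on the initial state. The seminorm of
`𝓗` bounds the derivatives; the functions `u` and `v` themselves are recovered by integrating `u_t`
and `v_t` in time. -/
theorem stableOnBounded (W : DecayWeights c₁ c₂ g h) :
    StableOnBounded (E := StateSpace) (generator c₁ c₂ g h) := by
  intro T hT
  obtain ⟨γ, hγ, hdec⟩ := W.exists_seminorm_le
  have hc₁ := W.c₁_pos
  have hc₂ := W.c₂_pos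
  set B := γ * (c₁ + c₂ + 2) with hB
  have hB0 : 0 ≤ B := by positivity
  refine ⟨B * T + 2 * (B / c₁) + 2 * (B / c₂) + B + 3, by positivity, fun z₀ z hz t ht => ?_⟩
  set N := ‖z₀‖ with hN
  have hN0 : 0 ≤ N := norm_nonneg z₀
  have n1 : ‖z₀.u‖ ≤ N := le_max_left _ _
  have n2 : ‖z₀.ut‖ ≤ N := (le_max_left _ _).trans (le_max_right _ _)
  have n3 : ‖z₀.v‖ ≤ N := (le_max_left _ _).trans ((le_max_right _ _).trans (le_max_right _ _))
  have n4 : ‖z₀.vt‖ ≤ N := (le_max_right _ _).trans ((le_max_right _ _).trans (le_max_right _ _))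
  have n5 : ‖z₀.u.deriv‖ ≤ N := (le_max_right _ _).trans n1
  have n6 : ‖z₀.v.deriv‖ ≤ N := (le_max_right _ _).trans n3
  have hs0 : z₀.seminorm c₁ c₂ ≤ (c₁ + c₂ + 2) * N := by
    refine le_of_sq_le_sq ?_ (by positivity)
    rw [seminorm_sq, mul_pow]
    have e1 := pow_le_pow_left₀ (norm_nonneg _) n2 2
    have e2 := pow_le_pow_left₀ (norm_nonneg _) n4 2
    have e3 := mul_le_mul_of_nonneg_left (pow_le_pow_left₀ (norm_nonneg _) n5 2) (sq_nonneg c₁)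
    have e4 := mul_le_mul_of_nonneg_left (pow_le_pow_left₀ (norm_nonneg _) n6 2) (sq_nonneg c₂)
    have e5 : 0 ≤ (2 * c₁ * c₂ + 4 * c₁ + 4 * c₂ + 2) * N ^ 2 := by positivity
    linarith
  have hs (s : ℝ) (hs : s ∈ Icc 0 T) : (z s).seminorm c₁ c₂ ≤ B * N := by
    refine (hdec T z₀ z hz s hs).trans ?_
    have he : Real.exp (-W.α * s) ≤ 1 := by
      refine Real.exp_le_one_iff.2 ?_
      have := mul_nonneg W.α_pos.le hs.1
      linarith
    have h1 : 0 ≤ z₀.seminorm c₁ c₂ := Real.sqrt_nonneg _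
    refine (mul_le_of_le_one_right (by positivity) he).trans ?_
    rw [hB, mul_assoc]
    gcongr
  have comp (s : ℝ) (h01 : s ∈ Icc 0 T) : ‖(z s).ut‖ ≤ B * N ∧ ‖(z s).vt‖ ≤ B * N ∧
      c₁ * ‖(z s).u.deriv‖ ≤ B * N ∧ c₂ * ‖(z s).v.deriv‖ ≤ B * N := by
    have h1 := hs s h01
    have h0 : 0 ≤ (z s).seminorm c₁ c₂ := Real.sqrt_nonneg _
    have h2 := seminorm_sq c₁ c₂ (z s)
    have p1 := sq_nonneg (c₁ * ‖(z s).u.deriv‖)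
    have p2 := sq_nonneg ‖(z s).ut‖
    have p3 := sq_nonneg (c₂ * ‖(z s).v.deriv‖)
    have p4 := sq_nonneg ‖(z s).vt‖
    rw [← mul_pow, ← mul_pow] at h2
    refine ⟨?_, ?_, ?_, ?_⟩ <;> exact (le_of_sq_le_sq (by linarith) h0).trans h1
  have hint (L : StateSpace →L[ℝ] L2) (hL : ∀ s ∈ Icc 0 T, ‖L (z s)‖ ≤ B * N) :
      ‖L (∫ s in (0 : ℝ)..t, z s)‖ ≤ B * N * T := by
    have e := ContinuousLinearMap.intervalIntegral_comp_comm (𝕜 := ℝ) (E := StateSpace) (F := L2) L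
      (hz.1.intervalIntegrable (μ := volume) 0 t)
    rw [← e]
    refine (intervalIntegral.norm_integral_le_of_norm_le_const (C := B * N) fun s hs => ?_).trans ?_
    · rw [uIoc_of_le ht.1] at hs
      exact hL s ⟨hs.1.le, hs.2.trans ht.2⟩
    · rw [sub_zero, abs_of_nonneg ht.1]
      gcongr
      exact ht.2
  obtain ⟨g1, g2, -⟩ := isGenerator_iff.1 (hz.2 t ht)
  obtain ⟨k1, k2, k3, k4⟩ := comp t ht
  have hwave (f f₀ : H1) (c : ℝ) (hc : 0 < c) (h1 : ‖H1.toL2 (f - f₀)‖ ≤ B * N * T)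
      (h2 : c * ‖f.deriv‖ ≤ B * N) (h3 : ‖f₀‖ ≤ N) :
      ‖f‖ ≤ (B * T + 2 * (B / c) + 3) * N := by
    have e1 := H1.norm_le (f - f₀)
    have e2 : ‖(f - f₀).deriv‖ ≤ ‖f.deriv‖ + ‖f₀.deriv‖ := norm_sub_le _ _
    have e3 : ‖f₀.deriv‖ ≤ N := (le_max_right _ _).trans h3
    have e4 : ‖f.deriv‖ ≤ B / c * N := by
      rw [div_mul_eq_mul_div, le_div_iff₀ hc]
      linarith
    have e5 := norm_le_norm_add_norm_sub' f f₀
    linarith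
  have hu := hwave (z t).u z₀.u c₁ hc₁ (g1 ▸ hint utL fun s hs => (comp s hs).1) k3 n1
  have hv := hwave (z t).v z₀.v c₂ hc₂ (g2 ▸ hint vtL fun s hs => (comp s hs).2.1) k4 n3
  have q1 : 0 ≤ B * T * N := by positivity
  have q2 : 0 ≤ B / c₁ * N := by positivity
  have q3 : 0 ≤ B / c₂ * N := by positivity
  have q4 : 0 ≤ B * N := by positivity
  rw [norm_eq]
  refine max_le ?_ (max_le ?_ (max_le ?_ ?_)) <;> linarith

end DecayWeights

end

/-! ### Existence by the d'Alembert formula -/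

/-- The velocity `u_t` of the solution of the wave equation whose Riemann coordinates are
`a (x + c t)` and `b (x - c t)`. -/
def waveVel (c : ℝ) (a b : C(ℝ, ℝ)) : C(ℝ, C(ℝ, ℝ)) :=
  ContinuousMap.curry ⟨fun p : ℝ × ℝ => (a (p.2 + c * p.1) + b (p.2 - c * p.1)) / 2, by fun_prop⟩

/-- The slope `u_x` of the solution of the wave equation whose Riemann coordinates are
`a (x + c t)` and `b (x - c t)`. -/
def waveSlope (c : ℝ) (a b : C(ℝ, ℝ)) : C(ℝ, C(ℝ, ℝ)) :=
  ContinuousMap.curry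
    ⟨fun p : ℝ × ℝ => (a (p.2 + c * p.1) - b (p.2 - c * p.1)) / (2 * c), by fun_prop⟩

theorem waveVel_apply (c : ℝ) (a b : C(ℝ, ℝ)) (t x : ℝ) :
    waveVel c a b t x = (a (x + c * t) + b (x - c * t)) / 2 := rfl

theorem waveSlope_apply (c : ℝ) (a b : C(ℝ, ℝ)) (t x : ℝ) :
    waveSlope c a b t x = (a (x + c * t) - b (x - c * t)) / (2 * c) := rfl

/-- Conservation of a transported quantity in the rectangle `[0,x] × [0,t]`. -/
theorem integral_transport (f : C(ℝ, ℝ)) {σ : ℝ} (hσ : σ ≠ 0) (t x : ℝ) :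
    σ * ((∫ s in (0 : ℝ)..t, f (x + σ * s)) - ∫ s in (0 : ℝ)..t, f (0 + σ * s)) =
      (∫ y in (0 : ℝ)..x, f (y + σ * t)) - ∫ y in (0 : ℝ)..x, f y := by
  have hi (a b : ℝ) : IntervalIntegrable f volume a b := f.continuous.intervalIntegrable a b
  rw [intervalIntegral.integral_comp_add_mul (f := f) hσ,
    intervalIntegral.integral_comp_add_mul (f := f) hσ,
    intervalIntegral.integral_comp_add_right (f := f), smul_eq_mul, smul_eq_mul, mul_sub,
    mul_inv_cancel_left₀ hσ, mul_inv_cancel_left₀ hσ]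
  simp only [mul_zero, add_zero, zero_add]
  have e1 := intervalIntegral.integral_add_adjacent_intervals (hi 0 x) (hi x (x + σ * t))
  have e2 := intervalIntegral.integral_add_adjacent_intervals (hi 0 (σ * t)) (hi (σ * t) (x + σ * t))
  linarith

theorem integral_waveVel_sub {c : ℝ} (hc : c ≠ 0) (a b : C(ℝ, ℝ)) (t x : ℝ) :
    (∫ s in (0 : ℝ)..t, waveVel c a b s x) - ∫ s in (0 : ℝ)..t, waveVel c a b s 0 =
      ∫ y in (0 : ℝ)..x, (waveSlope c a b t y - waveSlope c a b 0 y) := by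
  have ea := integral_transport a hc t x
  have eb := integral_transport b (neg_ne_zero.2 hc) t x
  simp only [neg_mul, ← sub_eq_add_neg] at eb
  simp only [waveVel_apply, waveSlope_apply, mul_zero, add_zero, sub_zero]
  have ia (f : C(ℝ, ℝ)) (m : ℝ → ℝ) (hm : Continuous m) (p q : ℝ) :
      IntervalIntegrable (fun s => f (m s)) volume p q :=
    (f.continuous.comp hm).intervalIntegrable p q
  rw [intervalIntegral.integral_div, intervalIntegral.integral_div,
    intervalIntegral.integral_add (ia a _ (by fun_prop) _ _) (ia b _ (by fun_prop) _ _),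
    intervalIntegral.integral_add (ia a _ (by fun_prop) _ _) (ia b _ (by fun_prop) _ _)]
  simp only [← sub_div]
  rw [intervalIntegral.integral_div, intervalIntegral.integral_sub
    ((ia a _ (by fun_prop) _ _).sub (ia b _ (by fun_prop) _ _))
    ((ia a _ (by fun_prop) _ _).sub (ia b _ (by fun_prop) _ _)),
    intervalIntegral.integral_sub (ia a _ (by fun_prop) _ _) (ia b _ (by fun_prop) _ _),
    intervalIntegral.integral_sub (a.continuous.intervalIntegrable _ _)
      (b.continuous.intervalIntegrable _ _)]
  field_simp
  linarith

theorem integral_waveSlope_sub {c : ℝ} (hc : c ≠ 0) (a b : C(ℝ, ℝ)) (t x : ℝ) :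
    (∫ s in (0 : ℝ)..t, waveSlope c a b s x) - ∫ s in (0 : ℝ)..t, waveSlope c a b s 0 =
      (c ^ 2)⁻¹ * ∫ y in (0 : ℝ)..x, (waveVel c a b t y - waveVel c a b 0 y) := by
  have ea := integral_transport a hc t x
  have eb := integral_transport b (neg_ne_zero.2 hc) t x
  simp only [neg_mul, ← sub_eq_add_neg] at eb
  simp only [waveVel_apply, waveSlope_apply, mul_zero, add_zero, sub_zero]
  have ia (f : C(ℝ, ℝ)) (m : ℝ → ℝ) (hm : Continuous m) (p q : ℝ) :
      IntervalIntegrable (fun s => f (m s)) volume p q :=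
    (f.continuous.comp hm).intervalIntegrable p q
  rw [intervalIntegral.integral_div, intervalIntegral.integral_div,
    intervalIntegral.integral_sub (ia a _ (by fun_prop) _ _) (ia b _ (by fun_prop) _ _),
    intervalIntegral.integral_sub (ia a _ (by fun_prop) _ _) (ia b _ (by fun_prop) _ _)]
  simp only [← sub_div]
  rw [intervalIntegral.integral_div, intervalIntegral.integral_sub
    ((ia a _ (by fun_prop) _ _).add (ia b _ (by fun_prop) _ _))
    ((ia a _ (by fun_prop) _ _).add (ia b _ (by fun_prop) _ _)),
    intervalIntegral.integral_add (ia a _ (by fun_prop) _ _) (ia b _ (by fun_prop) _ _),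
    intervalIntegral.integral_add (a.continuous.intervalIntegrable _ _)
      (b.continuous.intervalIntegrable _ _)]
  field_simp
  linarith

theorem continuous_restrL2_comp (Φ : C(ℝ, C(ℝ, ℝ))) : Continuous fun t => restrL2 (Φ t) :=
  contToL2.continuous.comp ((ContinuousMap.continuous_restrict (Icc (0 : ℝ) 1)).comp Φ.continuous)

/-- The integral in time of an `L²`-valued function can be computed pointwise. -/
theorem integral_restrL2 (Φ : C(ℝ, C(ℝ, ℝ))) (t : ℝ) {f : H1}
    (hf : ∀ x ∈ Icc (0 : ℝ) 1, f.eval x = ∫ s in (0 : ℝ)..t, Φ s x) :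
    ∫ s in (0 : ℝ)..t, restrL2 (Φ s) = H1.toL2 f := by
  have hc : Continuous fun s => (Φ s).restrict (Icc (0 : ℝ) 1) :=
    (ContinuousMap.continuous_restrict (Icc (0 : ℝ) 1)).comp Φ.continuous
  have h1 := contToL2.intervalIntegral_comp_comm (hc.intervalIntegrable (μ := volume) 0 t)
  refine h1.trans ?_
  change _ = contToL2 f.1.1
  congr 1
  ext x
  have h2 := (ContinuousMap.evalCLM ℝ x).intervalIntegral_comp_comm
    (hc.intervalIntegrable (μ := volume) 0 t)
  have h3 := hf x x.2
  rw [H1.eval, projIcc_val] at h3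
  exact h2.symm.trans h3.symm

theorem H1.eval_ofDeriv_restrL2 (k : ℝ) (ψ : C(ℝ, ℝ)) {x : ℝ} (hx : x ∈ Icc (0 : ℝ) 1) :
    (H1.ofDeriv (k, restrL2 ψ)).eval x = k + ∫ y in (0 : ℝ)..x, ψ y := by
  rw [H1.eval_eq _ hx, H1.ofDeriv_eval_zero, H1.ofDeriv_deriv]
  congr 1
  have h := (ae_restrict_iff' measurableSet_Icc).1 (restrL2_ae ψ)
  refine intervalIntegral.integral_congr_ae ?_
  filter_upwards [h] with y hy hyx
  rw [uIoc_of_le hx.1] at hyx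
  exact hy ⟨hyx.1.le, hyx.2.trans hx.2⟩

/-- The displacement of the d'Alembert solution since time `0`. -/
def waveDisp (c : ℝ) (a b : C(ℝ, ℝ)) (t : ℝ) : H1 :=
  H1.ofDeriv (∫ s in (0 : ℝ)..t, waveVel c a b s 0,
    restrL2 (waveSlope c a b t) - restrL2 (waveSlope c a b 0))

theorem waveDisp_eval {c : ℝ} (hc : c ≠ 0) (a b : C(ℝ, ℝ)) (t : ℝ) {x : ℝ}
    (hx : x ∈ Icc (0 : ℝ) 1) :
    (waveDisp c a b t).eval x = ∫ s in (0 : ℝ)..t, waveVel c a b s x := by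
  rw [waveDisp, ← map_sub, H1.eval_ofDeriv_restrL2 _ _ hx]
  have := integral_waveVel_sub hc a b t x
  simp only [ContinuousMap.sub_apply]
  linarith

/-- The slope of the d'Alembert solution, integrated in time. -/
def waveSlopeInt (c : ℝ) (a b : C(ℝ, ℝ)) (t : ℝ) : H1 :=
  H1.ofDeriv (∫ s in (0 : ℝ)..t, waveSlope c a b s 0,
    (c ^ 2)⁻¹ • (restrL2 (waveVel c a b t) - restrL2 (waveVel c a b 0)))

theorem waveSlopeInt_eval {c : ℝ} (hc : c ≠ 0) (a b : C(ℝ, ℝ)) (t : ℝ) {x : ℝ}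
    (hx : x ∈ Icc (0 : ℝ) 1) :
    (waveSlopeInt c a b t).eval x = ∫ s in (0 : ℝ)..t, waveSlope c a b s x := by
  rw [waveSlopeInt, ← map_sub, ← map_smul, H1.eval_ofDeriv_restrL2 _ _ hx]
  have := integral_waveSlope_sub hc a b t x
  simp only [ContinuousMap.sub_apply, ContinuousMap.smul_apply, smul_eq_mul,
    intervalIntegral.integral_const_mul]
  linarith

/-- The state with Riemann coordinates `a`, `b` (for `u`) and `p`, `r` (for `v`), and `u(0) = k`. -/
def ofRiemann (c₁ c₂ : ℝ) (x : ℝ × L2 × L2 × L2 × L2) : StateSpace :=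
  StateSpace.mk (x.1, (2 * c₁)⁻¹ • (x.2.1 - x.2.2.1), (2 : ℝ)⁻¹ • (x.2.1 + x.2.2.1),
    (2 * c₂)⁻¹ • (x.2.2.2.1 - x.2.2.2.2), (2 : ℝ)⁻¹ • (x.2.2.2.1 + x.2.2.2.2))

theorem continuous_ofRiemann (c₁ c₂ : ℝ) : Continuous (ofRiemann c₁ c₂) := by
  refine StateSpace.mk.continuous.comp ?_
  fun_prop

theorem ofRiemann_surjective {c₁ c₂ : ℝ} (hc₁ : c₁ ≠ 0) (hc₂ : c₂ ≠ 0) :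
    Function.Surjective (ofRiemann c₁ c₂) := by
  intro z
  refine ⟨(z.u.eval 0, z.ut + c₁ • z.u.deriv, z.ut - c₁ • z.u.deriv,
    z.vt + c₂ • z.v.deriv, z.vt - c₂ • z.v.deriv), ?_⟩
  have e1 (c : ℝ) (hc : c ≠ 0) (f f' : L2) :
      (2 * c)⁻¹ • ((f + c • f') - (f - c • f')) = f' := by
    rw [add_sub_sub_cancel, ← add_smul, smul_smul, ← two_mul, inv_mul_cancel₀ (by positivity),
      one_smul]
  have e2 (c : ℝ) (f f' : L2) : (2 : ℝ)⁻¹ • ((f + c • f') + (f - c • f')) = f := by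
    rw [add_add_sub_cancel, ← two_smul ℝ, inv_smul_smul₀ two_ne_zero]
  conv_rhs => rw [← StateSpace.mk_components z]
  simp only [ofRiemann, e1 c₁ hc₁, e1 c₂ hc₂, e2]

/-- The d'Alembert formula gives a solution of the closed loop as long as the boundary conditions
hold. -/
theorem isMildSolution_dAlembert {c₁ c₂ g h T : ℝ} (hc₁ : c₁ ≠ 0) (hc₂ : c₂ ≠ 0)
    {a b p r : C(ℝ, ℝ)} (k : ℝ)
    (hl : ∀ t ∈ Icc 0 T, waveSlope c₁ a b t 0 = g * waveVel c₁ a b t 0)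
    (hj : ∀ t ∈ Icc 0 T, waveVel c₁ a b t 1 = waveVel c₂ p r t 0)
    (hj' : ∀ t ∈ Icc 0 T, waveSlope c₂ p r t 0 = waveSlope c₁ a b t 1)
    (hr : ∀ t ∈ Icc 0 T, waveSlope c₂ p r t 1 = -h * waveVel c₂ p r t 1) :
    ∃ z, IsMildSolution (E := StateSpace) (generator c₁ c₂ g h) T
      (ofRiemann c₁ c₂ (k, restrL2 a, restrL2 b, restrL2 p, restrL2 r)) z := by
  set z : ℝ → StateSpace := fun t => StateSpace.mk (k + ∫ s in (0 : ℝ)..t, waveVel c₁ a b s 0,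
    restrL2 (waveSlope c₁ a b t), restrL2 (waveVel c₁ a b t),
    restrL2 (waveSlope c₂ p r t), restrL2 (waveVel c₂ p r t)) with hz
  have hcont (c : ℝ) (f f' : C(ℝ, ℝ)) (x : ℝ) : Continuous fun s => waveVel c f f' s x := by
    simp only [waveVel_apply]
    fun_prop
  have hzc : Continuous z := by
    refine StateSpace.mk.continuous.comp (Continuous.prodMk ?_
      ((continuous_restrL2_comp _).prodMk ((continuous_restrL2_comp _).prodMk
        ((continuous_restrL2_comp _).prodMk (continuous_restrL2_comp _)))))
    exact continuous_const.add
      (intervalIntegral.continuous_primitive (fun _ _ => (hcont _ _ _ _).intervalIntegrable _ _) 0)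
  have hz0 : ofRiemann c₁ c₂ (k, restrL2 a, restrL2 b, restrL2 p, restrL2 r) = z 0 := by
    have e1 (c : ℝ) (f f' : C(ℝ, ℝ)) :
        (2 * c)⁻¹ • (restrL2 f - restrL2 f') = restrL2 (waveSlope c f f' 0) := by
      rw [← map_sub, ← map_smul]
      refine restrL2_congr fun x _ => ?_
      simp only [waveSlope_apply, ContinuousMap.smul_apply, ContinuousMap.sub_apply, mul_zero,
        add_zero, sub_zero, smul_eq_mul]
      rw [div_eq_inv_mul]
    have e2 (c : ℝ) (f f' : C(ℝ, ℝ)) :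
        (2 : ℝ)⁻¹ • (restrL2 f + restrL2 f') = restrL2 (waveVel c f f' 0) := by
      rw [← map_add, ← map_smul]
      refine restrL2_congr fun x _ => ?_
      simp only [waveVel_apply, ContinuousMap.smul_apply, ContinuousMap.add_apply, mul_zero,
        add_zero, sub_zero, smul_eq_mul]
      rw [div_eq_inv_mul]
    simp only [ofRiemann, hz, e1, e2 c₁ a b, e2 c₂ p r, intervalIntegral.integral_same, add_zero]
  have m0 : (0 : ℝ) ∈ Icc (0 : ℝ) 1 := ⟨le_rfl, zero_le_one⟩
  have m1 : (1 : ℝ) ∈ Icc (0 : ℝ) 1 := ⟨zero_le_one, le_rfl⟩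
  rw [hz0]
  refine ⟨z, isMildSolution_iff.2 ⟨hzc, fun t ht => ?_⟩⟩
  have hIcc : uIcc 0 t ⊆ Icc 0 T := by
    rw [uIcc_of_le ht.1]
    exact Icc_subset_Icc_right ht.2
  have hint (L : StateSpace →L[ℝ] L2) :
      L (∫ s in (0 : ℝ)..t, z s) = ∫ s in (0 : ℝ)..t, L (z s) :=
    (ContinuousLinearMap.intervalIntegral_comp_comm (𝕜 := ℝ) (E := StateSpace) (F := L2) L
      (hzc.intervalIntegrable (μ := volume) 0 t)).symm
  have hu : (z t - z 0).u = waveDisp c₁ a b t := by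
    change H1.ofDeriv _ - H1.ofDeriv _ = H1.ofDeriv _
    rw [← map_sub]
    congr 1
    simp
  have hv : (z t - z 0).v = waveDisp c₂ p r t := by
    have e : (z t - z 0).v = H1.ofDeriv ((z t - z 0).u.eval 1,
        restrL2 (waveSlope c₂ p r t) - restrL2 (waveSlope c₂ p r 0)) := by
      rw [eval_one_eq]
      exact (H1.ofDeriv_eval_deriv _).symm
    rw [e, hu, waveDisp_eval hc₁ _ _ _ m1,
      intervalIntegral.integral_congr fun s hs => hj s (hIcc hs), waveDisp]
  refine isGenerator_iff.2 ⟨?_, ?_, waveSlopeInt c₁ a b t, waveSlopeInt c₂ p r t,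
    ?_, ?_, ?_, ?_, ?_, ?_, ?_⟩
  · rw [hu]
    exact (hint utL).trans (integral_restrL2 _ t fun x hx => waveDisp_eval hc₁ a b t hx)
  · rw [hv]
    exact (hint vtL).trans (integral_restrL2 _ t fun x hx => waveDisp_eval hc₂ p r t hx)
  · exact (hint (H1.derivL.comp uL)).trans
      (integral_restrL2 _ t fun x hx => waveSlopeInt_eval hc₁ a b t hx)
  · exact (hint (H1.derivL.comp vL)).trans
      (integral_restrL2 _ t fun x hx => waveSlopeInt_eval hc₂ p r t hx)
  · rw [waveSlopeInt, H1.ofDeriv_deriv, smul_inv_smul₀ (by positivity)]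
    rfl
  · rw [waveSlopeInt, H1.ofDeriv_deriv, smul_inv_smul₀ (by positivity)]
    rfl
  · rw [hu, waveSlopeInt_eval hc₁ _ _ _ m0, waveDisp_eval hc₁ _ _ _ m0,
      intervalIntegral.integral_congr fun s hs => hl s (hIcc hs),
      intervalIntegral.integral_const_mul]
  · rw [waveSlopeInt_eval hc₁ _ _ _ m1, waveSlopeInt_eval hc₂ _ _ _ m0]
    exact intervalIntegral.integral_congr fun s hs => hj' s (hIcc hs)
  · rw [hv, waveSlopeInt_eval hc₂ _ _ _ m1, waveDisp_eval hc₂ _ _ _ m1,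
      intervalIntegral.integral_congr fun s hs => hr s (hIcc hs),
      intervalIntegral.integral_const_mul]

/-- For test functions as Riemann coordinates of the initial state, the solution exists up to the
time that a wave needs for the shorter crossing: until then, every outgoing Riemann coordinate is
given by the initial state, and the incoming ones are obtained from the boundary conditions. -/
theorem exists_isMildSolution_test {c₁ c₂ g h : ℝ} (hc₁ : 0 < c₁) (hc₂ : 0 < c₂)
    (hg : 1 + c₁ * g ≠ 0) (hh : 1 + c₂ * h ≠ 0) {a b p r : C(ℝ, ℝ)} (ha : IsTest a) (hb : IsTest b)
    (hp : IsTest p) (hr : IsTest r) (k : ℝ) :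
    ∃ z, IsMildSolution (E := StateSpace) (generator c₁ c₂ g h) (min (1 / c₁) (1 / c₂))
      (ofRiemann c₁ c₂ (k, restrL2 a, restrL2 b, restrL2 p, restrL2 r)) z := by
  -- The reflection and transmission coefficients at the two ends and at the junction.
  set κ₁ := (1 - c₁ * g) / (1 + c₁ * g) with hκ₁
  set κ₂ := (1 - c₂ * h) / (1 + c₂ * h) with hκ₂
  set k₁₁ := (c₂ - c₁) / (c₁ + c₂) with hk₁₁
  set k₁₂ := 2 * c₁ / (c₁ + c₂) with hk₁₂
  set k₂₁ := 2 * c₂ / (c₁ + c₂) with hk₂₁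
  set k₂₂ := (c₁ - c₂) / (c₁ + c₂) with hk₂₂
  -- The profiles of the Riemann coordinates on `ℝ`: the initial profile, continued beyond the end
  -- where the coordinate enters by the reflected and transmitted waves.
  let a' : C(ℝ, ℝ) := ⟨fun s => a s + k₁₁ * b (2 - s) + k₁₂ * p (c₂ * (s - 1) / c₁), by fun_prop⟩
  let b' : C(ℝ, ℝ) := ⟨fun s => b s + κ₁ * a (-s), by fun_prop⟩
  let p' : C(ℝ, ℝ) := ⟨fun s => p s + κ₂ * r (2 - s), by fun_prop⟩
  let r' : C(ℝ, ℝ) := ⟨fun s => r s + k₂₁ * b (1 + c₁ * s / c₂) + k₂₂ * p (-s), by fun_prop⟩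
  have va (s : ℝ) : a' s = a s + k₁₁ * b (2 - s) + k₁₂ * p (c₂ * (s - 1) / c₁) := rfl
  have vb (s : ℝ) : b' s = b s + κ₁ * a (-s) := rfl
  have vp (s : ℝ) : p' s = p s + κ₂ * r (2 - s) := rfl
  have vr (s : ℝ) : r' s = r s + k₂₁ * b (1 + c₁ * s / c₂) + k₂₂ * p (-s) := rfl
  have ea : restrL2 a = restrL2 a' := restrL2_congr fun x hx => by
    rw [va, hb.zero_of_ge (2 - x) (by linarith [hx.2]), hp.zero_of_le (c₂ * (x - 1) / c₁)
      (div_nonpos_of_nonpos_of_nonneg (by nlinarith [hx.2]) hc₁.le)]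
    ring
  have eb : restrL2 b = restrL2 b' := restrL2_congr fun x hx => by
    rw [vb, ha.zero_of_le (-x) (by linarith [hx.1])]
    ring
  have ep : restrL2 p = restrL2 p' := restrL2_congr fun x hx => by
    rw [vp, hr.zero_of_ge (2 - x) (by linarith [hx.2])]
    ring
  have er : restrL2 r = restrL2 r' := restrL2_congr fun x hx => by
    have : 0 ≤ c₁ * x / c₂ := div_nonneg (mul_nonneg hc₁.le hx.1) hc₂.le
    rw [vr, hb.zero_of_ge (1 + c₁ * x / c₂) (by linarith), hp.zero_of_le (-x) (by linarith [hx.1])]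
    ring
  rw [ea, eb, ep, er]
  have bound (t : ℝ) (ht : t ∈ Icc 0 (min (1 / c₁) (1 / c₂))) :
      0 ≤ c₁ * t ∧ c₁ * t ≤ 1 ∧ 0 ≤ c₂ * t ∧ c₂ * t ≤ 1 := by
    refine ⟨mul_nonneg hc₁.le ht.1, ?_, mul_nonneg hc₂.le ht.1, ?_⟩
    · have := (le_div_iff₀ hc₁).1 (ht.2.trans (min_le_left _ _))
      linarith
    · have := (le_div_iff₀ hc₂).1 (ht.2.trans (min_le_right _ _))
      linarith
  have hsum : c₁ + c₂ ≠ 0 := by positivity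
  have junction (t : ℝ) (ht : t ∈ Icc 0 (min (1 / c₁) (1 / c₂))) :
      a' (1 + c₁ * t) = k₁₁ * b' (1 - c₁ * t) + k₁₂ * p' (c₂ * t) ∧
      r' (-(c₂ * t)) = k₂₁ * b' (1 - c₁ * t) + k₂₂ * p' (c₂ * t) := by
    obtain ⟨h1, h2, h3, h4⟩ := bound t ht
    rw [va, vr, vb, vp, ha.zero_of_ge (1 + c₁ * t) (by linarith),
      hr.zero_of_le (-(c₂ * t)) (by linarith), ha.zero_of_le (-(1 - c₁ * t)) (by linarith),
      hr.zero_of_ge (2 - c₂ * t) (by linarith)]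
    have e1 : 2 - (1 + c₁ * t) = 1 - c₁ * t := by ring
    have e2 : c₂ * (1 + c₁ * t - 1) / c₁ = c₂ * t := by
      field_simp
      ring
    have e3 : 1 + c₁ * -(c₂ * t) / c₂ = 1 - c₁ * t := by
      field_simp
      ring
    rw [e1, e2, e3, neg_neg]
    constructor <;> ring
  refine isMildSolution_dAlembert hc₁.ne' hc₂.ne' k (fun t ht => ?_) (fun t ht => ?_)
    (fun t ht => ?_) (fun t ht => ?_)
  · obtain ⟨h1, h2, -⟩ := bound t ht
    rw [waveSlope_apply, waveVel_apply, zero_add, zero_sub, va, vb, neg_neg,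
      hb.zero_of_ge (2 - c₁ * t) (by linarith), hb.zero_of_le (-(c₁ * t)) (by linarith),
      hp.zero_of_le (c₂ * (c₁ * t - 1) / c₁)
        (div_nonpos_of_nonpos_of_nonneg (by nlinarith) hc₁.le), hκ₁]
    field_simp
    ring
  · obtain ⟨j1, j2⟩ := junction t ht
    rw [waveVel_apply, waveVel_apply, zero_add, zero_sub, j1, j2, hk₁₁, hk₁₂, hk₂₁, hk₂₂]
    field_simp
    ring
  · obtain ⟨j1, j2⟩ := junction t ht
    rw [waveSlope_apply, waveSlope_apply, zero_add, zero_sub, j1, j2, hk₁₁, hk₁₂, hk₂₁, hk₂₂]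
    field_simp
    ring
  · obtain ⟨-, -, h3, h4⟩ := bound t ht
    have h5 : 0 ≤ c₁ * (1 - c₂ * t) / c₂ :=
      div_nonneg (mul_nonneg hc₁.le (by linarith)) hc₂.le
    have e1 : 2 - (1 + c₂ * t) = 1 - c₂ * t := by ring
    rw [waveSlope_apply, waveVel_apply, vp, vr, e1, hp.zero_of_ge (1 + c₂ * t) (by linarith),
      hb.zero_of_ge (1 + c₁ * (1 - c₂ * t) / c₂) (by linarith),
      hp.zero_of_le (-(1 - c₂ * t)) (by linarith), hκ₂]
    field_simp
    ring

/-- Local existence for all initial states. The initial states for which a solution exists form a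
closed set, which contains those with test functions as Riemann coordinates. -/
theorem DecayWeights.exists_isMildSolution {c₁ c₂ g h : ℝ} (W : DecayWeights c₁ c₂ g h)
    (hg : 1 + c₁ * g ≠ 0) (hh : 1 + c₂ * h ≠ 0) (z₀ : StateSpace) :
    ∃ z, IsMildSolution (E := StateSpace) (generator c₁ c₂ g h) (min (1 / c₁) (1 / c₂)) z₀ z := by
  have hc₁ := W.c₁_pos
  have hc₂ := W.c₂_pos
  have hcl := W.stableOnBounded.isClosed_solvable (isClosed_generator hc₁ hc₂ g h)
    (T := min (1 / c₁) (1 / c₂)) (by positivity)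
  set D := (univ : Set ℝ) ×ˢ ((testL2 : Set L2) ×ˢ ((testL2 : Set L2) ×ˢ
    ((testL2 : Set L2) ×ˢ (testL2 : Set L2)))) with hD
  have hd : Dense D :=
    dense_univ.prod (dense_testL2.prod (dense_testL2.prod (dense_testL2.prod dense_testL2)))
  have hsub : D ⊆ ofRiemann c₁ c₂ ⁻¹' {z₀ : StateSpace | ∃ z, IsMildSolution (E := StateSpace)
      (generator c₁ c₂ g h) (min (1 / c₁) (1 / c₂)) z₀ z} := by
    rintro ⟨k, wa, wb, wp, wr⟩ ⟨-, ⟨a, ha, rfl⟩, ⟨b, hb, rfl⟩, ⟨p, hp, rfl⟩, ⟨r, hr, rfl⟩⟩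
    exact exists_isMildSolution_test hc₁ hc₂ hg hh ha hb hp hr k
  obtain ⟨x, rfl⟩ := ofRiemann_surjective hc₁.ne' hc₂.ne' z₀
  exact (hcl.preimage (continuous_ofRiemann c₁ c₂)).closure_subset_iff.2 hsub (hd x)

/-! ### The matrix inequality -/

/-- The energy of the incoming Riemann coordinates as a function of the velocity at the left end, the
slope and the velocity at the junction, and the velocity at the right end. -/
def incoming (c₁ c₂ g h S₁ S₂ S₃ S₄ : ℝ) (x : Fin 4 → ℝ) : ℝ :=
  S₁ * (x 2 + c₁ * x 1) ^ 2 + S₂ * ((1 - c₁ * g) * x 0) ^ 2 +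
    S₃ * ((1 - c₂ * h) * x 3) ^ 2 + S₄ * (x 2 - c₂ * x 1) ^ 2

/-- The energy of the outgoing Riemann coordinates, in the variables of `incoming`. -/
def outgoing (c₁ c₂ g h S₁ S₂ S₃ S₄ : ℝ) (x : Fin 4 → ℝ) : ℝ :=
  S₁ * ((1 + c₁ * g) * x 0) ^ 2 + S₂ * (x 2 - c₁ * x 1) ^ 2 +
    S₃ * (x 2 + c₂ * x 1) ^ 2 + S₄ * ((1 + c₂ * h) * x 3) ^ 2

theorem dotProduct_matPsiTilde (c₁ c₂ g h S₁ S₂ S₃ S₄ : ℝ) (x : Fin 4 → ℝ) :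
    dotProduct x ((-matPsiTilde c₁ c₂ g h S₁ S₂ S₃ S₄).mulVec x) =
      outgoing c₁ c₂ g h S₁ S₂ S₃ S₄ x - incoming c₁ c₂ g h S₁ S₂ S₃ S₄ x := by
  simp [matPsiTilde, matPsi, matH, matG, matQ, matE, matS, Matrix.mul_apply, Fin.sum_univ_succ,
    Matrix.diagonal_apply, dotProduct, Matrix.mulVec, incoming, outgoing]
  ring

/-- A continuous quadratic form which is smaller than another one away from `0` is smaller by a
factor less than `1`. -/
theorem exists_one_add_mul_le {ι : Type*} [Fintype ι] {p q : (ι → ℝ) → ℝ} (hp : Continuous p)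
    (hq : Continuous q) (hp2 : ∀ (r : ℝ) x, p (r • x) = r ^ 2 * p x)
    (hq2 : ∀ (r : ℝ) x, q (r • x) = r ^ 2 * q x) (hpq : ∀ x, x ≠ 0 → p x < q x) :
    ∃ δ : ℝ, 0 < δ ∧ ∀ x, (1 + δ) * p x ≤ q x := by
  have hS : IsCompact (Metric.sphere (0 : ι → ℝ) 1) := isCompact_sphere 0 1
  have hpos : ∀ x ∈ Metric.sphere (0 : ι → ℝ) 1, 0 < q x - p x := fun x hx =>
    sub_pos.2 (hpq x fun h => by simp [h] at hx)
  obtain ⟨m, hm, hmq⟩ : ∃ m : ℝ, 0 < m ∧ ∀ x ∈ Metric.sphere (0 : ι → ℝ) 1, m ≤ q x - p x :=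
    hS.exists_forall_le' (hq.sub hp).continuousOn hpos
  obtain ⟨M, hM⟩ := hS.exists_bound_of_continuousOn hp.continuousOn
  refine ⟨m / (|M| + 1), by positivity, fun x => ?_⟩
  rcases eq_or_ne x 0 with rfl | hx
  · have h1 := hp2 0 0
    have h2 := hq2 0 0
    simp only [zero_smul, zero_pow two_ne_zero, zero_mul] at h1 h2
    rw [h1, h2, mul_zero]
  have hn : ‖x‖ ≠ 0 := norm_ne_zero_iff.2 hx
  have hu : ‖x‖⁻¹ • x ∈ Metric.sphere (0 : ι → ℝ) 1 := by
    rw [mem_sphere_zero_iff_norm, norm_smul, norm_inv, norm_norm, inv_mul_cancel₀ hn]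
  have key : (1 + m / (|M| + 1)) * p (‖x‖⁻¹ • x) ≤ q (‖x‖⁻¹ • x) := by
    have h1 := hmq _ hu
    have h2 : p (‖x‖⁻¹ • x) ≤ |M| + 1 :=
      (((le_abs_self _).trans (hM _ hu)).trans (le_abs_self M)).trans (by linarith)
    have h3 : m / (|M| + 1) * p (‖x‖⁻¹ • x) ≤ m := by
      rw [div_mul_eq_mul_div, div_le_iff₀ (by positivity)]
      gcongr
    linarith
  have hxu : ‖x‖ • ‖x‖⁻¹ • x = x := smul_inv_smul₀ hn x
  rw [← hxu, hp2, hq2, mul_left_comm]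
  exact mul_le_mul_of_nonneg_left key (sq_nonneg _)

section

variable {c₁ c₂ g h S₁ S₂ S₃ S₄ : ℝ}

theorem incoming_lt_outgoing (hP : (-matPsiTilde c₁ c₂ g h S₁ S₂ S₃ S₄).PosDef) {x : Fin 4 → ℝ}
    (hx : x ≠ 0) : incoming c₁ c₂ g h S₁ S₂ S₃ S₄ x < outgoing c₁ c₂ g h S₁ S₂ S₃ S₄ x := by
  have := hP.dotProduct_mulVec_pos hx
  rw [star_trivial, dotProduct_matPsiTilde] at this
  linarith

/-- If `1 + c₁ g = 0`, then the outgoing Riemann coordinate at the left end is zero for every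
velocity there, and the incoming energy cannot be smaller. -/
theorem one_add_left_ne_zero (hS₂ : 0 < S₂)
    (hP : (-matPsiTilde c₁ c₂ g h S₁ S₂ S₃ S₄).PosDef) : 1 + c₁ * g ≠ 0 := by
  intro h0
  have hx : (![1, 0, 0, 0] : Fin 4 → ℝ) ≠ 0 := fun h => one_ne_zero (congrFun h 0)
  have := incoming_lt_outgoing hP hx
  simp [incoming, outgoing, h0] at this
  nlinarith [sq_nonneg (1 - c₁ * g)]

/-- The analogue of `one_add_left_ne_zero` for the right end. -/
theorem one_add_right_ne_zero (hS₃ : 0 < S₃)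
    (hP : (-matPsiTilde c₁ c₂ g h S₁ S₂ S₃ S₄).PosDef) : 1 + c₂ * h ≠ 0 := by
  intro h0
  have hx : (![0, 0, 0, 1] : Fin 4 → ℝ) ≠ 0 := fun h => one_ne_zero (congrFun h 3)
  have := incoming_lt_outgoing hP hx
  simp [incoming, outgoing, h0] at this
  nlinarith [sq_nonneg (1 - c₂ * h)]

/-- The strict matrix inequality at the rate `0` persists for a small positive rate. -/
theorem exists_decayWeights (hc₁ : 0 < c₁) (hc₂ : 0 < c₂) (hS₁ : 0 < S₁) (hS₂ : 0 < S₂)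
    (hS₃ : 0 < S₃) (hS₄ : 0 < S₄) (hP : (-matPsiTilde c₁ c₂ g h S₁ S₂ S₃ S₄).PosDef) :
    Nonempty (DecayWeights c₁ c₂ g h) := by
  obtain ⟨δ, hδ, hle⟩ := exists_one_add_mul_le
    (p := incoming c₁ c₂ g h S₁ S₂ S₃ S₄) (q := outgoing c₁ c₂ g h S₁ S₂ S₃ S₄)
    (by unfold incoming; fun_prop) (by unfold outgoing; fun_prop)
    (fun r x => by simp only [incoming, Pi.smul_apply, smul_eq_mul]; ring)
    (fun r x => by simp only [outgoing, Pi.smul_apply, smul_eq_mul]; ring)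
    (fun x hx => incoming_lt_outgoing hP hx)
  have hlog : 0 < Real.log (1 + δ) := Real.log_pos (by linarith)
  -- With this rate, the weights grow by at most the factor `1 + δ` over the unit interval.
  set α := Real.log (1 + δ) * min c₁ c₂ / 2 with hα
  have hexp (c : ℝ) (hc : 0 < c) (hmin : min c₁ c₂ ≤ c) : Real.exp (2 * α / c) ≤ 1 + δ := by
    rw [← Real.le_log_iff_exp_le (by positivity), div_le_iff₀ hc, hα]
    have := mul_le_mul_of_nonneg_left hmin hlog.le
    linarith
  have hmin : 0 < min c₁ c₂ := lt_min hc₁ hc₂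
  refine ⟨⟨hc₁, hc₂, S₁, S₂, S₃, S₄, α, hS₁, hS₂, hS₃, hS₄, by positivity,
    fun p₀ w p₁ r₁ => le_trans ?_ (hle ![p₀, w, p₁, r₁])⟩⟩
  have e1 := hexp c₁ hc₁ (min_le_left _ _)
  have e2 := hexp c₂ hc₂ (min_le_right _ _)
  have d1 := mul_le_mul_of_nonneg_right e1 (mul_nonneg hS₁.le (sq_nonneg (p₁ + c₁ * w)))
  have d2 := mul_le_mul_of_nonneg_right e1 (mul_nonneg hS₂.le (sq_nonneg ((1 - c₁ * g) * p₀)))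
  have d3 := mul_le_mul_of_nonneg_right e2 (mul_nonneg hS₃.le (sq_nonneg ((1 - c₂ * h) * r₁)))
  have d4 := mul_le_mul_of_nonneg_right e2 (mul_nonneg hS₄.le (sq_nonneg (p₁ - c₂ * w)))
  have hin : incoming c₁ c₂ g h S₁ S₂ S₃ S₄ ![p₀, w, p₁, r₁] = S₁ * (p₁ + c₁ * w) ^ 2 +
      S₂ * ((1 - c₁ * g) * p₀) ^ 2 + S₃ * ((1 - c₂ * h) * r₁) ^ 2 + S₄ * (p₁ - c₂ * w) ^ 2 := rfl
  rw [hin]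
  linarith

end

end

end WaveLoop

theorem mainTheorem3 (c₁ c₂ g h : ℝ) (hc₁ : 0 < c₁) (hc₂ : 0 < c₂)
    (hLMI : ∃ S₁ S₂ S₃ S₄ : ℝ, 0 < S₁ ∧ 0 < S₂ ∧ 0 < S₃ ∧ 0 < S₄ ∧
      (-WaveLoop.matPsiTilde c₁ c₂ g h S₁ S₂ S₃ S₄).PosDef) :
    ∃ γ : ℝ, 1 < γ ∧ ∃ α : ℝ, 0 < α ∧
      ∀ z₀ : WaveLoop.StateSpace, ∃ z : ℝ → WaveLoop.StateSpace,
        WaveLoop.IsSolution c₁ c₂ g h 0 z₀ z ∧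
        (∀ z' : ℝ → WaveLoop.StateSpace, WaveLoop.IsSolution c₁ c₂ g h 0 z₀ z' →
          ∀ t : ℝ, 0 ≤ t → z' t = z t) ∧
        ∀ t : ℝ, 0 ≤ t →
          (z t).seminorm c₁ c₂ ≤ γ * z₀.seminorm c₁ c₂ * Real.exp (-α * t) := by
  obtain ⟨S₁, S₂, S₃, S₄, hS₁, hS₂, hS₃, hS₄, hP⟩ := hLMI
  obtain ⟨W⟩ := WaveLoop.exists_decayWeights hc₁ hc₂ hS₁ hS₂ hS₃ hS₄ hP
  obtain ⟨γ, hγ, hdec⟩ := W.exists_seminorm_le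
  refine ⟨γ, hγ, W.α, W.α_pos, fun z₀ => ?_⟩
  have hlocal := W.exists_isMildSolution (WaveLoop.one_add_left_ne_zero hS₂ hP)
    (WaveLoop.one_add_right_ne_zero hS₃ hP)
  have hglobal (T : ℝ) := WaveLoop.StableOnBounded.exists_of_exists (E := WaveLoop.StateSpace)
    (G := WaveLoop.generator c₁ c₂ g h) (fun _ => WaveLoop.eq_zero_of_isGenerator_zero)
    (τ := min (1 / c₁) (1 / c₂)) (by positivity) hlocal T z₀
  obtain ⟨z, hzc, hz, hagree⟩ := W.stableOnBounded.exists_global z₀ hglobal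
  refine ⟨z, ⟨hzc, hz⟩, fun z' hz' t ht => ?_, fun t ht => ?_⟩
  · obtain ⟨y, hy, hzy⟩ := hagree t ht
    have hz'' := WaveLoop.IsMildSolution.of_continuousOn (E := WaveLoop.StateSpace)
      (G := WaveLoop.generator c₁ c₂ g h) (T := t) hz'.1 hz'.2
    have h1 := W.stableOnBounded.unique hz'' hy ⟨ht, le_rfl⟩
    rw [max_eq_left ht] at h1
    rw [hzy t ⟨ht, le_rfl⟩, h1]
  · obtain ⟨y, hy, hzy⟩ := hagree t ht
    rw [hzy t ⟨ht, le_rfl⟩]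
    exact hdec t z₀ y hy t ⟨ht, le_rfl⟩
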